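/- Let $1\le p<2$ and let $\sigma,\tau:(0,\infty)\to\mathbb R$ satisfy $\sigma\in\ell^p(L^1)$ and $Q:=\tau-\sigma^2\in\ell^p(L^1)$, where $\ell^p(L^1)$ is the space of measurable $f$ on $(0,\infty)$ with $\|f\|_{\ell^p(L^1)}^p=\sum_{j\ge 0}\big(\int_j^{j+1}|f(x)|\,dx\big)^p<\infty$. Let $\{E^m_j : m\ge 1,\ 1\le j\le 2^m\}$ be a martingale structure on $(0,\infty)$, that is, a family of (possibly empty) subintervals such that for each $m$ the sets $E^m_1,\dots,E^m_{2^m}$ are pairwise disjoint with union $(0,\infty)$, $x<x'$ whenever $x\in E^m_i$, $x'\in E^m_j$ and $i<j$, and $E^m_j=E^{m+1}_{2j-1}\cup E^{m+1}_{2j}$. Assume that it is adapted in $\ell^p(L^1)$ to $f=|\tau-\sigma^2|+|\sigma|$, that is, $\|f\chi_{E^m_j}\|^p_{\ell^p(L^1)}\le 2^{-m}\|f\|^p_{\ell^p(L^1)}$ for all $m,j$. For $E>0$ put $k=\sqrt E$ and $$\mathcal F(x,E)=-\frac{i}{2k}\,e^{-ih(x,E)}\big(Q(x)+2ik\,\sigma(x)\big),\qquad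 h(x,E)=2kx-\int_0^x\frac{Q(t)}{k}\,dt .$$ For locally integrable $g$ let $$\|g\|_{\mathcal B_1}=\sum_{m=1}^\infty m\Big(\sum_{j=1}^{2^m}\Big|\int_{E^m_j}g(x)\,dx\Big|^2\Big)^{1/2}\in[0,\infty],$$ where integrals over unbounded intervals are understood as $\int_{E^m_j}g\,dx=\lim_{y\to\infty}\int_{E^m_j\cap(0,y]}g\,dx$. Then for Lebesgue-a.e. $E>0$ all the integrals $\int_{E^m_j}\mathcal F(x,E)\chi_{[M,\infty)}(x)\,dx$ ($M\in\mathbb R$, $m\ge1$, $1\le j\le 2^m$) converge, and $$\limsup_{M\to\infty}\big\|\mathcal F(\cdot,E)\chi_{[M,\infty)}\big\|_{\mathcal B_1}=0 .$$ -/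

import Mathlib

open MeasureTheory Filter Topology Set
open scoped ENNReal

noncomputable section

/-- The amalgam quantity `‖f‖_{ℓ^p(L^1)} = (∑_j (∫_j^{j+1} |f|)^p)^{1/p}` on the half-line
`(0, ∞)`, with values in `[0, ∞]`. -/
def lpL1Norm (p : ℝ) (f : ℝ → ℝ) : ℝ≥0∞ :=
  (∑' j : ℕ, (∫⁻ x in Ioc (j : ℝ) ((j : ℝ) + 1), ‖f x‖ₑ) ^ p) ^ (1 / p)

/-- Membership of (the restriction to `(0, ∞)` of) `f` in `ℓ^p(L^1)`. -/
def MemLpL1 (p : ℝ) (f : ℝ → ℝ) : Prop :=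
  AEStronglyMeasurable f (volume.restrict (Ioi 0)) ∧ lpL1Norm p f < ∞

/-- A martingale structure on `(0, ∞)`: a family of (possibly empty) subintervals `I m j`,
indexed by `m ≥ 1` and `1 ≤ j ≤ 2 ^ m`; the values of `I` at other indices play no role. -/
structure IsMartingaleStructure (I : ℕ → ℕ → Set ℝ) : Prop where
  ordConnected : ∀ m, 1 ≤ m → ∀ j ∈ Finset.Icc 1 (2 ^ m), (I m j).OrdConnected
  cover : ∀ m, 1 ≤ m → ⋃ j ∈ Finset.Icc 1 (2 ^ m), I m j = Ioi 0
  disjoint : ∀ m, 1 ≤ m → ∀ i ∈ Finset.Icc 1 (2 ^ m), ∀ j ∈ Finset.Icc 1 (2 ^ m),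
    i ≠ j → I m i ∩ I m j = ∅
  ordered : ∀ m, 1 ≤ m → ∀ i ∈ Finset.Icc 1 (2 ^ m), ∀ j ∈ Finset.Icc 1 (2 ^ m),
    i < j → ∀ x ∈ I m i, ∀ y ∈ I m j, x < y
  split : ∀ m, 1 ≤ m → ∀ j ∈ Finset.Icc 1 (2 ^ m),
    I m j = I (m + 1) (2 * j - 1) ∪ I (m + 1) (2 * j)

/-- The structure `I` is adapted in `ℓ^p(L^1)` to `f`:
`‖f χ_{I m j}‖^p ≤ 2^{-m} ‖f‖^p` for all `m`, `j`. -/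
def IsAdapted (p : ℝ) (I : ℕ → ℕ → Set ℝ) (f : ℝ → ℝ) : Prop :=
  ∀ m, 1 ≤ m → ∀ j ∈ Finset.Icc 1 (2 ^ m),
    lpL1Norm p ((I m j).indicator f) ^ p ≤ (2 : ℝ≥0∞)⁻¹ ^ m * lpL1Norm p f ^ p

/-- `c` is the integral of `f` over `A ⊆ (0, ∞)`, in the sense
`c = lim_{y → ∞} ∫_{A ∩ (0, y]} f`. For a locally integrable function that is not absolutely
integrable on `A` this is the only sense in which the integral can exist. -/
def HasHalfLineIntegral (f : ℝ → ℂ) (A : Set ℝ) (c : ℂ) : Prop :=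
  Tendsto (fun y : ℝ => ∫ x in A ∩ Ioc 0 y, f x) atTop (𝓝 c)

/-- The value `lim_{y → ∞} ∫_{A ∩ (0, y]} f`; meaningful when that limit exists. -/
def halfLineIntegral (f : ℝ → ℂ) (A : Set ℝ) : ℂ :=
  limUnder atTop (fun y : ℝ => ∫ x in A ∩ Ioc 0 y, f x)

/-- The quantity `‖f‖_{𝓑_s} = ∑_{m ≥ 1} m^s (∑_{j = 1}^{2^m} |∫_{I m j} f|^2)^{1/2}` with values
in `[0, ∞]`, relative to the structure `I`; the outer sum is indexed by `n = m - 1`. -/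
def BNorm (s : ℝ) (I : ℕ → ℕ → Set ℝ) (f : ℝ → ℂ) : ℝ≥0∞ :=
  ∑' n : ℕ, ((n + 1 : ℕ) : ℝ≥0∞) ^ s *
    (∑ j ∈ Finset.Icc 1 (2 ^ (n + 1)),
      ‖halfLineIntegral f (I (n + 1) j)‖ₑ ^ 2) ^ (1 / 2 : ℝ)

/-- `Q = τ - σ²`. -/
def effQ (σ τ : ℝ → ℝ) (x : ℝ) : ℝ := τ x - σ x ^ 2

/-- `Q̃(x, E) = Q(x) + 2 i √E σ(x)`. -/
def effQTilde (σ τ : ℝ → ℝ) (x E : ℝ) : ℂ :=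
  (effQ σ τ x : ℂ) + 2 * Complex.I * (√E : ℂ) * (σ x : ℂ)

/-- The phase `h(x, E) = 2 √E x - ∫_0^x Q(t) / √E dt`. -/
def phaseH (σ τ : ℝ → ℝ) (x E : ℝ) : ℝ :=
  2 * √E * x - ∫ t in (0 : ℝ)..x, effQ σ τ t / √E

/-- The amplitude `w(x, E) = - i / (2 √E)`. -/
def ampW (_x E : ℝ) : ℂ := -(Complex.I / (2 * (√E : ℂ)))

/-- `𝓕(x, E) = w(x, E) e^{-i h(x, E)} Q̃(x, E)`. -/
def kernelF (σ τ : ℝ → ℝ) (x E : ℝ) : ℂ :=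
  ampW x E * Complex.exp (-(Complex.I * (phaseH σ τ x E : ℂ))) * effQTilde σ τ x E

/-- `𝓕(·, E) χ_{[M, ∞)}`. -/
def tailF (σ τ : ℝ → ℝ) (E M : ℝ) : ℝ → ℂ :=
  (Ici M).indicator (fun x => kernelF σ τ x E)

end

/-!
With `k = √E` and `P(x) = ∫_0^x Q`, the phase is `h(x, k²) = 2 k x - P(x) / k`, and the integral of
`𝓕` over a bounded set `A` is a combination, with coefficients bounded on compact sets of `k`, of
the oscillatory transforms `T g (k) = ∫ exp (-i (2 k x - P(x) / k)) g(x) dx` of `g = Q χ_A` and of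
`g = σ χ_A`.

*The `L²` estimate.* Expanding the square, `∫ φ(k) |T g (k)|² dk` is a bilinear form in `g` whose
kernel is `∫ φ(k) exp (-i (2 k r - c / k)) dk` with `r = x - y`, `c = P(x) - P(y)`. Two integrations
by parts bound it by `(1 + |c|)² / r²`. Hölder's inequality over unit cells gives
`|c| ≲ (1 + |r|) ^ (1 - 1 / p)`, so the kernel is `O((1 + |r|) ^ (-2 / p))`, which is integrable in
`r` because `p < 2`. Schur's test bounds the form by the square of the `ℓ²(L¹)` norm of `g`
(`exists_forall_lintegral_oscTransform_le`).

*Decay in `m`.* Since `ℓ^p(L¹) ⊆ ℓ²(L¹)` and the structure is adapted in `ℓ^p(L¹)`, summing over the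
at most `2 ^ m` bounded intervals of level `m` gives a bound by a multiple of `2 ^ (m (1 - 2 / p))`
for the integral over `k` of `∑_j |∫_{I m j} 𝓕|²`. Hence for almost every `k` these sums decay
geometrically in `m` (`ae_exists_geometricDecay`). No interpolation between `L¹` and `L²` is needed.

*Consequences of the decay.* For a fixed such `k` the rest is deterministic. An integral over
`I m j ∩ (0, y]` with `y ∈ I m j` splits into complete bounded intervals, at most one from each
level above `m`, so it is at most a geometric tail
(`GeometricDecay.norm_integral_inter_le`). This gives the Cauchy property of `y ↦ ∫_0^y 𝓕`, hence
the convergence of all the integrals. At level `m` only two of the truncated integrals can differ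
from `0` and from integrals over complete bounded intervals, so the `m`-th summand of the
`𝓑_1` norm of the tail is `O(m θ ^ m)` uniformly in the truncation point, and it tends to `0` with
the truncation. Dominated convergence for series concludes (`GeometricDecay.tendsto_BNorm`).
-/

/-! ### Integrals along a martingale structure -/

namespace IsMartingaleStructure

variable {I : ℕ → ℕ → Set ℝ}

theorem measurableSet (hI : IsMartingaleStructure I) {m j : ℕ} (hm : 1 ≤ m)
    (hj : j ∈ Finset.Icc 1 (2 ^ m)) : MeasurableSet (I m j) :=
  (hI.ordConnected m hm j hj).measurableSet

theorem subset_Ioi (hI : IsMartingaleStructure I) {m j : ℕ} (hm : 1 ≤ m)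
    (hj : j ∈ Finset.Icc 1 (2 ^ m)) : I m j ⊆ Ioi 0 := by
  rw [← hI.cover m hm]
  exact Set.subset_biUnion_of_mem (u := fun j => I m j) hj

theorem left_mem {m j : ℕ} (hj : j ∈ Finset.Icc 1 (2 ^ m)) :
    2 * j - 1 ∈ Finset.Icc 1 (2 ^ (m + 1)) := by
  rw [Finset.mem_Icc] at *; rw [pow_succ]; omega

theorem right_mem {m j : ℕ} (hj : j ∈ Finset.Icc 1 (2 ^ m)) :
    2 * j ∈ Finset.Icc 1 (2 ^ (m + 1)) := by
  rw [Finset.mem_Icc] at *; rw [pow_succ]; omega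

/-- An interval of the structure that is unbounded above contains the ray from each of its
points. -/
theorem Ici_subset (hI : IsMartingaleStructure I) {m j : ℕ} (hm : 1 ≤ m)
    (hj : j ∈ Finset.Icc 1 (2 ^ m)) (hub : ¬ BddAbove (I m j)) {x : ℝ} (hx : x ∈ I m j) :
    Ici x ⊆ I m j := by
  intro y hy
  obtain ⟨z, hz, hyz⟩ := not_bddAbove_iff.1 hub y
  exact (hI.ordConnected m hm j hj).out hx hz ⟨hy, hyz.le⟩

theorem eq_of_mem (hI : IsMartingaleStructure I) {m i j : ℕ} (hm : 1 ≤ m)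
    (hi : i ∈ Finset.Icc 1 (2 ^ m)) (hj : j ∈ Finset.Icc 1 (2 ^ m)) {x : ℝ}
    (hxi : x ∈ I m i) (hxj : x ∈ I m j) : i = j := by
  by_contra h
  have : x ∈ I m i ∩ I m j := ⟨hxi, hxj⟩
  rw [hI.disjoint m hm i hi j hj h] at this
  exact this

theorem eq_of_not_bddAbove (hI : IsMartingaleStructure I) {m i j : ℕ} (hm : 1 ≤ m)
    (hi : i ∈ Finset.Icc 1 (2 ^ m)) (hj : j ∈ Finset.Icc 1 (2 ^ m))
    (hui : ¬ BddAbove (I m i)) (huj : ¬ BddAbove (I m j)) : i = j := by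
  obtain ⟨x, hx, -⟩ := not_bddAbove_iff.1 hui 0
  obtain ⟨y, hy, hxy⟩ := not_bddAbove_iff.1 huj x
  exact hI.eq_of_mem hm hi hj (hI.Ici_subset hm hi hui hx hxy.le) hy

theorem exists_not_bddAbove (hI : IsMartingaleStructure I) {m : ℕ} (hm : 1 ≤ m) :
    ∃ j ∈ Finset.Icc 1 (2 ^ m), ¬ BddAbove (I m j) := by
  by_contra! h
  have : BddAbove (⋃ j ∈ Finset.Icc 1 (2 ^ m), I m j) :=
    (Finset.finite_toSet _).bddAbove_biUnion.2 h
  rw [hI.cover m hm] at this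
  exact not_bddAbove_Ioi 0 this

end IsMartingaleStructure

open Classical in
/-- The sum `∑_j |∫_{I m j} F|²` over those `j` for which the interval `I m j` is bounded, so that
no improper integral occurs in it. -/
noncomputable def bddSquareSum (I : ℕ → ℕ → Set ℝ) (F : ℝ → ℂ) (m : ℕ) : ℝ :=
  ∑ j ∈ Finset.Icc 1 (2 ^ m) with BddAbove (I m j), ‖∫ x in I m j, F x‖ ^ 2

/-- The data from which everything else about the integrals of `F` over the intervals `I m j` is
deduced: geometric decay of the square sums over bounded intervals and, for each fixed `y`,
convergence to `0` as `m → ∞`, uniform in `j` but without any rate, of the integrals over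
`I m j ∩ (0, y]`. -/
structure GeometricDecay (I : ℕ → ℕ → Set ℝ) (F : ℝ → ℂ) (C θ : ℝ) : Prop where
  integrableOn : ∀ y, IntegrableOn F (Ioc 0 y)
  nonneg : 0 ≤ C
  pos : 0 < θ
  lt_one : θ < 1
  squareSum_le : ∀ m, 1 ≤ m → bddSquareSum I F m ≤ (C * θ ^ m) ^ 2
  small : ∀ y, ∃ ε : ℕ → ℝ, Tendsto ε atTop (𝓝 0) ∧
    ∀ m, 1 ≤ m → ∀ j ∈ Finset.Icc 1 (2 ^ m), ‖∫ x in I m j ∩ Ioc 0 y, F x‖ ≤ ε m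

theorem sum_enorm_sq_rpow_half {ι : Type*} (s : Finset ι) (v : ι → ℂ) :
    (∑ j ∈ s, ‖v j‖ₑ ^ 2) ^ (1 / 2 : ℝ) = ENNReal.ofReal (√(∑ j ∈ s, ‖v j‖ ^ 2)) := by
  rw [Real.sqrt_eq_rpow, ← ENNReal.ofReal_rpow_of_nonneg (Finset.sum_nonneg fun _ _ => sq_nonneg _)
    (by norm_num), ENNReal.ofReal_sum_of_nonneg fun _ _ => sq_nonneg _]
  congr 1
  refine Finset.sum_congr rfl fun j _ => ?_
  rw [ENNReal.ofReal_pow (norm_nonneg _), ofReal_norm]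

namespace GeometricDecay

variable {I : ℕ → ℕ → Set ℝ} {F : ℝ → ℂ} {C θ : ℝ}

theorem norm_integral_le (h : GeometricDecay I F C θ) {m j : ℕ} (hm : 1 ≤ m)
    (hj : j ∈ Finset.Icc 1 (2 ^ m)) (hb : BddAbove (I m j)) :
    ‖∫ x in I m j, F x‖ ≤ C * θ ^ m := by
  classical
  have h0 : 0 ≤ C * θ ^ m := mul_nonneg h.nonneg (pow_nonneg h.pos.le _)
  refine le_of_sq_le_sq ?_ h0
  refine le_trans ?_ (h.squareSum_le m hm)
  exact Finset.single_le_sum (f := fun j => ‖∫ x in I m j, F x‖ ^ 2)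
    (fun _ _ => by positivity) (Finset.mem_filter.2 ⟨hj, hb⟩)

/-- Descending from level `m` to level `m + n` inside `I m j`, the part of `I m j` to the left of
`y` picks up at most one complete interval of each level, and each of these is bounded. -/
theorem norm_integral_inter_le_sum (h : GeometricDecay I F C θ) (hI : IsMartingaleStructure I)
    {y : ℝ} {ε : ℕ → ℝ}
    (hε : ∀ m, 1 ≤ m → ∀ j ∈ Finset.Icc 1 (2 ^ m), ‖∫ x in I m j ∩ Ioc 0 y, F x‖ ≤ ε m) (n : ℕ) :
    ∀ m, 1 ≤ m → ∀ j ∈ Finset.Icc 1 (2 ^ m), y ∈ I m j →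
      ‖∫ x in I m j ∩ Ioc 0 y, F x‖ ≤ ∑ i ∈ Finset.range n, C * θ ^ (m + 1 + i) + ε (m + n) := by
  induction n with
  | zero => intro m hm j hj _; simpa using hε m hm j hj
  | succ n ih =>
    intro m hm j hj hy
    have hl := IsMartingaleStructure.left_mem hj
    have hr := IsMartingaleStructure.right_mem hj
    have hm1 : 1 ≤ m + 1 := by omega
    have hlr : 2 * j - 1 < 2 * j := by have := (Finset.mem_Icc.1 hj).1; omega
    have hord := hI.ordered (m + 1) hm1 _ hl _ hr hlr
    have hsum : ∑ i ∈ Finset.range (n + 1), C * θ ^ (m + 1 + i) =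
        C * θ ^ (m + 1) + ∑ i ∈ Finset.range n, C * θ ^ (m + 1 + 1 + i) := by
      rw [Finset.sum_range_succ']
      rw [add_comm]
      congr 1
      refine Finset.sum_congr rfl fun i _ => ?_
      congr 2; omega
    have hidx : m + (n + 1) = m + 1 + n := by omega
    have hC : 0 ≤ C * θ ^ (m + 1) := mul_nonneg h.nonneg (pow_nonneg h.pos.le _)
    rw [hsum, hidx]
    have hsplit := hI.split m hm j hj
    rw [hsplit] at hy
    rcases hy with hy | hy
    · have : I m j ∩ Ioc 0 y = I (m + 1) (2 * j - 1) ∩ Ioc 0 y := by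
        rw [hsplit]
        ext x
        constructor
        · rintro ⟨hx | hx, hxy⟩
          · exact ⟨hx, hxy⟩
          · exact absurd (hord y hy x hx) (not_lt.2 hxy.2)
        · rintro ⟨hx, hxy⟩
          exact ⟨Or.inl hx, hxy⟩
      rw [this]
      have := ih (m + 1) hm1 _ hl hy
      linarith
    · have hset : I m j ∩ Ioc 0 y = I (m + 1) (2 * j - 1) ∪ (I (m + 1) (2 * j) ∩ Ioc 0 y) := by
        rw [hsplit]
        ext x
        constructor
        · rintro ⟨hx | hx, hxy⟩
          · exact Or.inl hx
          · exact Or.inr ⟨hx, hxy⟩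
        · rintro (hx | ⟨hx, hxy⟩)
          · exact ⟨Or.inl hx, hI.subset_Ioi hm1 hl hx, (hord x hx y hy).le⟩
          · exact ⟨Or.inr hx, hxy⟩
      have hsub : I (m + 1) (2 * j - 1) ⊆ Ioc 0 y := fun x hx =>
        ⟨hI.subset_Ioi hm1 hl hx, (hord x hx y hy).le⟩
      rw [hset, setIntegral_union]
      · refine (norm_add_le _ _).trans ?_
        have h1 := h.norm_integral_le hm1 hl ⟨y, fun x hx => (hsub hx).2⟩
        have h2 := ih (m + 1) hm1 _ hr hy
        linarith
      · refine Set.disjoint_left.2 fun x hx hx' => ?_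
        exact lt_irrefl _ (hord x hx x hx'.1)
      · exact (hI.measurableSet hm1 hr).inter measurableSet_Ioc
      · exact (h.integrableOn y).mono_set hsub
      · exact (h.integrableOn y).mono_set inter_subset_right

/-- Partial integrals over `I m j` are controlled by the full integrals over the bounded intervals
of the higher levels. -/
theorem norm_integral_inter_le (h : GeometricDecay I F C θ) (hI : IsMartingaleStructure I)
    {m j : ℕ} (hm : 1 ≤ m) (hj : j ∈ Finset.Icc 1 (2 ^ m)) {y : ℝ} (hy : y ∈ I m j) :
    ‖∫ x in I m j ∩ Ioc 0 y, F x‖ ≤ C / (1 - θ) * θ ^ m := by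
  obtain ⟨ε, hε0, hε⟩ := h.small y
  have hθ : 0 < 1 - θ := sub_pos.2 h.lt_one
  have key : ∀ n, ‖∫ x in I m j ∩ Ioc 0 y, F x‖ ≤ C / (1 - θ) * θ ^ m + ε (m + n) := by
    intro n
    refine (h.norm_integral_inter_le_sum hI hε n m hm j hj hy).trans ?_
    gcongr
    have : ∑ i ∈ Finset.range n, C * θ ^ (m + 1 + i) =
        C * θ ^ (m + 1) * ∑ i ∈ Finset.range n, θ ^ i := by
      rw [Finset.mul_sum]
      refine Finset.sum_congr rfl fun i _ => by ring
    rw [this]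
    have hgeo : ∑ i ∈ Finset.range n, θ ^ i ≤ (1 - θ)⁻¹ := by
      rw [← tsum_geometric_of_lt_one h.pos.le h.lt_one]
      exact (summable_geometric_of_lt_one h.pos.le h.lt_one).sum_le_tsum _
        (fun i _ => pow_nonneg h.pos.le i)
    have hle : C * θ ^ (m + 1) ≤ C * θ ^ m :=
      mul_le_mul_of_nonneg_left (pow_le_pow_of_le_one h.pos.le h.lt_one.le (by omega)) h.nonneg
    calc C * θ ^ (m + 1) * ∑ i ∈ Finset.range n, θ ^ i
        ≤ C * θ ^ m * (1 - θ)⁻¹ :=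
          mul_le_mul hle hgeo (Finset.sum_nonneg fun i _ => pow_nonneg h.pos.le i)
            (mul_nonneg h.nonneg (pow_nonneg h.pos.le _))
      _ = C / (1 - θ) * θ ^ m := by ring
  have hlim : Tendsto (fun n => C / (1 - θ) * θ ^ m + ε (m + n)) atTop
      (𝓝 (C / (1 - θ) * θ ^ m + 0)) :=
    tendsto_const_nhds.add (hε0.comp (tendsto_add_atTop_nat m |>.congr fun n => by rw [add_comm]))
  rw [add_zero] at hlim
  exact ge_of_tendsto' hlim key

theorem integral_inter_sub (h : GeometricDecay I F C θ) {A : Set ℝ} (hA : MeasurableSet A)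
    {x y : ℝ} (hxy : x ≤ y) :
    (∫ t in A ∩ Ioc 0 y, F t) - ∫ t in A ∩ Ioc 0 x, F t = ∫ t in A ∩ (Ioc 0 y ∩ Ioi x), F t := by
  rw [sub_eq_iff_eq_add', ← setIntegral_union]
  · congr 2
    ext t
    simp only [mem_inter_iff, mem_union, mem_Ioc, mem_Ioi]
    constructor
    · rintro ⟨h1, h2, h3⟩
      rcases le_or_gt t x with h4 | h4
      · exact Or.inl ⟨h1, h2, h4⟩
      · exact Or.inr ⟨h1, ⟨h2, h3⟩, h4⟩
    · rintro (⟨h1, h2, h3⟩ | ⟨h1, ⟨h2, h3⟩, h4⟩)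
      · exact ⟨h1, h2, h3.trans hxy⟩
      · exact ⟨h1, h2, h3⟩
  · refine Set.disjoint_left.2 fun t ht ht' => ?_
    exact absurd ht'.2.2 (not_lt.2 ht.2.2)
  · exact hA.inter (measurableSet_Ioc.inter measurableSet_Ioi)
  · exact (h.integrableOn x).mono_set inter_subset_right
  · exact (h.integrableOn y).mono_set fun t ht => ht.2.1

/-- Past a point of an unbounded interval `A` of the structure, the integrals over `(0, y]` and
over `A ∩ (0, y]` differ by a constant. -/
theorem integral_sub_eq_of_Ici_subset (h : GeometricDecay I F C θ) {A : Set ℝ}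
    (hA : MeasurableSet A) {x y : ℝ} (hx : Ici x ⊆ A) (hxy : x ≤ y) :
    (∫ t in A ∩ Ioc 0 y, F t) - ∫ t in A ∩ Ioc 0 x, F t =
      (∫ t in Ioc 0 y, F t) - ∫ t in Ioc 0 x, F t := by
  have h1 := h.integral_inter_sub hA hxy
  have h2 := h.integral_inter_sub MeasurableSet.univ hxy
  simp only [univ_inter] at h2
  rw [h1, h2]
  congr 2
  ext t
  simp only [mem_inter_iff, mem_Ioc, mem_Ioi]
  exact ⟨fun ht => ht.2, fun ht => ⟨hx ht.2.le, ht⟩⟩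

theorem tendsto_pow (h : GeometricDecay I F C θ) (K : ℝ) :
    Tendsto (fun m : ℕ => K * θ ^ m) atTop (𝓝 0) := by
  simpa using (tendsto_pow_atTop_nhds_zero_of_lt_one h.pos.le h.lt_one).const_mul K

/-- Both endpoints of a short tail `(x, y]` lie in the unbounded interval of a high level. -/
theorem exists_tendsto_integral_Ioc (h : GeometricDecay I F C θ) (hI : IsMartingaleStructure I) :
    ∃ c : ℂ, Tendsto (fun y : ℝ => ∫ x in Ioc 0 y, F x) atTop (𝓝 c) := by
  refine cauchy_map_iff_exists_tendsto.1 (Metric.cauchy_iff.2 ⟨inferInstance, fun ε hε => ?_⟩)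
  obtain ⟨m, hmε, hm⟩ := (((h.tendsto_pow (4 * (C / (1 - θ)))).eventually (gt_mem_nhds hε)).and
    (eventually_ge_atTop 1)).exists
  obtain ⟨j, hj, hub⟩ := hI.exists_not_bddAbove hm
  obtain ⟨x₀, hx₀, -⟩ := not_bddAbove_iff.1 hub 0
  have hsub := hI.Ici_subset hm hj hub hx₀
  have key : ∀ y, x₀ ≤ y →
      ‖(∫ x in Ioc 0 y, F x) - ∫ x in Ioc 0 x₀, F x‖ ≤ 2 * (C / (1 - θ) * θ ^ m) := by
    intro y hy
    rw [← h.integral_sub_eq_of_Ici_subset (hI.measurableSet hm hj) hsub hy]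
    refine (norm_sub_le _ _).trans ?_
    have h1 := h.norm_integral_inter_le hI hm hj (hsub hy)
    have h2 := h.norm_integral_inter_le hI hm hj hx₀
    linarith
  refine ⟨_, image_mem_map (Ici_mem_atTop x₀), ?_⟩
  rintro _ ⟨x, hx, rfl⟩ _ ⟨y, hy, rfl⟩
  rw [dist_eq_norm]
  calc ‖(∫ t in Ioc 0 x, F t) - ∫ t in Ioc 0 y, F t‖
      = ‖((∫ t in Ioc 0 x, F t) - ∫ t in Ioc 0 x₀, F t) -
          ((∫ t in Ioc 0 y, F t) - ∫ t in Ioc 0 x₀, F t)‖ := by congr 1; ring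
    _ ≤ _ := norm_sub_le _ _
    _ ≤ 2 * (C / (1 - θ) * θ ^ m) + 2 * (C / (1 - θ) * θ ^ m) := add_le_add (key x hx) (key y hy)
    _ = 4 * (C / (1 - θ)) * θ ^ m := by ring
    _ < ε := hmε

theorem integral_inter_eq_of_upperBound {m j : ℕ} (hI : IsMartingaleStructure I) (hm : 1 ≤ m)
    (hj : j ∈ Finset.Icc 1 (2 ^ m)) {y : ℝ} (hy : y ∈ upperBounds (I m j)) :
    ∫ x in I m j ∩ Ioc 0 y, F x = ∫ x in I m j, F x := by
  have hsub : I m j ⊆ Ioc 0 y := fun x hx => ⟨hI.subset_Ioi hm hj hx, hy hx⟩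
  rw [inter_eq_left.2 hsub]

theorem exists_tendsto_integral_inter (h : GeometricDecay I F C θ) (hI : IsMartingaleStructure I)
    {m j : ℕ} (hm : 1 ≤ m) (hj : j ∈ Finset.Icc 1 (2 ^ m)) :
    ∃ c : ℂ, Tendsto (fun y : ℝ => ∫ x in I m j ∩ Ioc 0 y, F x) atTop (𝓝 c) := by
  by_cases hb : BddAbove (I m j)
  · obtain ⟨B, hB⟩ := hb
    refine ⟨∫ x in I m j, F x, tendsto_const_nhds.congr' ?_⟩
    filter_upwards [eventually_ge_atTop B] with y hy
    exact (integral_inter_eq_of_upperBound hI hm hj fun x hx => (hB hx).trans hy).symm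
  · obtain ⟨x₀, hx₀, -⟩ := not_bddAbove_iff.1 hb 0
    obtain ⟨c, hc⟩ := h.exists_tendsto_integral_Ioc hI
    refine ⟨c - (∫ t in Ioc 0 x₀, F t) + ∫ t in I m j ∩ Ioc 0 x₀, F t,
      ((hc.sub_const _).add_const _).congr' ?_⟩
    filter_upwards [eventually_ge_atTop x₀] with y hy
    rw [← h.integral_sub_eq_of_Ici_subset (hI.measurableSet hm hj)
      (hI.Ici_subset hm hj hb hx₀) hy]
    ring

/-- Truncating `F` to `[M, ∞)` subtracts the integral up to `M`; for `M ≤ 0` nothing is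
subtracted. -/
theorem hasHalfLineIntegral_indicator (h : GeometricDecay I F C θ) {A : Set ℝ}
    (hA : MeasurableSet A) {c : ℂ}
    (hc : Tendsto (fun y : ℝ => ∫ x in A ∩ Ioc 0 y, F x) atTop (𝓝 c)) (M : ℝ) :
    HasHalfLineIntegral ((Ici M).indicator F) A (c - ∫ x in A ∩ Ioc 0 M, F x) := by
  refine (hc.sub_const _).congr' ?_
  filter_upwards [eventually_ge_atTop M] with y hy
  rw [h.integral_inter_sub hA hy, setIntegral_indicator measurableSet_Ici, inter_assoc]
  refine setIntegral_congr_set ?_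
  exact (ae_eq_refl A).inter ((ae_eq_refl _).inter Ioi_ae_eq_Ici)

theorem eq_integral_of_bddAbove {m j : ℕ} {c : ℂ} (hI : IsMartingaleStructure I) (hm : 1 ≤ m)
    (hj : j ∈ Finset.Icc 1 (2 ^ m))
    (hc : Tendsto (fun y : ℝ => ∫ x in I m j ∩ Ioc 0 y, F x) atTop (𝓝 c))
    (hb : BddAbove (I m j)) : c = ∫ x in I m j, F x := by
  obtain ⟨B, hB⟩ := hb
  refine tendsto_nhds_unique hc (tendsto_const_nhds.congr' ?_)
  filter_upwards [eventually_ge_atTop B] with y hy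
  exact (integral_inter_eq_of_upperBound hI hm hj fun x hx => (hB hx).trans hy).symm

theorem norm_le_of_tendsto (h : GeometricDecay I F C θ) (hI : IsMartingaleStructure I)
    {m j : ℕ} (hm : 1 ≤ m) (hj : j ∈ Finset.Icc 1 (2 ^ m)) {c : ℂ}
    (hc : Tendsto (fun y : ℝ => ∫ x in I m j ∩ Ioc 0 y, F x) atTop (𝓝 c)) : ‖c‖ ≤ C / (1 - θ) * θ ^ m := by
  by_cases hb : BddAbove (I m j)
  · rw [eq_integral_of_bddAbove hI hm hj hc hb]
    refine (h.norm_integral_le hm hj hb).trans ?_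
    have : C ≤ C / (1 - θ) := by
      rw [le_div_iff₀ (sub_pos.2 h.lt_one)]
      nlinarith [h.nonneg, h.pos]
    exact mul_le_mul_of_nonneg_right this (pow_nonneg h.pos.le _)
  · obtain ⟨x₀, hx₀, -⟩ := not_bddAbove_iff.1 hb 0
    refine le_of_tendsto hc.norm ?_
    filter_upwards [eventually_ge_atTop x₀] with y hy
    exact h.norm_integral_inter_le hI hm hj (hI.Ici_subset hm hj hb hx₀ hy)

/-- A point outside an interval of the structure lies to the left or to the right of it. -/
theorem norm_tail_le_of_notMem (hI : IsMartingaleStructure I)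
    {m j : ℕ} (hm : 1 ≤ m) (hj : j ∈ Finset.Icc 1 (2 ^ m)) {c : ℂ}
    (hc : Tendsto (fun y : ℝ => ∫ x in I m j ∩ Ioc 0 y, F x) atTop (𝓝 c))
    {M : ℝ} (hM : M ∉ I m j) :
    ‖c - ∫ x in I m j ∩ Ioc 0 M, F x‖ ≤ ‖c‖ := by
  by_cases hl : ∀ x ∈ I m j, M < x
  · have : I m j ∩ Ioc 0 M = ∅ := by
      ext x
      simp only [mem_inter_iff, mem_Ioc, mem_empty_iff_false, iff_false]
      exact fun hx => absurd (hl x hx.1) (not_lt.2 hx.2.2)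
    simp [this]
  · push Not at hl
    obtain ⟨x, hx, hxM⟩ := hl
    have hub : M ∈ upperBounds (I m j) := by
      intro z hz
      by_contra hzM
      exact hM ((hI.ordConnected m hm j hj).out hx hz ⟨hxM, (not_le.1 hzM).le⟩)
    rw [integral_inter_eq_of_upperBound hI hm hj hub,
      eq_integral_of_bddAbove hI hm hj hc ⟨M, hub⟩]
    simp

theorem norm_tail_le (h : GeometricDecay I F C θ) (hI : IsMartingaleStructure I)
    {m j : ℕ} (hm : 1 ≤ m) (hj : j ∈ Finset.Icc 1 (2 ^ m)) {c : ℂ}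
    (hc : Tendsto (fun y : ℝ => ∫ x in I m j ∩ Ioc 0 y, F x) atTop (𝓝 c))
    (M : ℝ) :
    ‖c - ∫ x in I m j ∩ Ioc 0 M, F x‖ ≤ 2 * (C / (1 - θ) * θ ^ m) := by
  have h1 := h.norm_le_of_tendsto hI hm hj hc
  have h0 := norm_nonneg c
  by_cases hM : M ∈ I m j
  · have h2 := h.norm_integral_inter_le hI hm hj hM
    exact (norm_sub_le _ _).trans (by linarith)
  · exact (norm_tail_le_of_notMem hI hm hj hc hM).trans (by linarith)

/-- At each level, at most two truncated integrals differ from integrals over bounded intervals: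
the one over the interval that contains `M` and the one over the unbounded interval. -/
theorem sum_norm_tail_sq_le (h : GeometricDecay I F C θ) (hI : IsMartingaleStructure I)
    {m : ℕ} (hm : 1 ≤ m) {c : ℕ → ℂ}
    (hc : ∀ j ∈ Finset.Icc 1 (2 ^ m),
      Tendsto (fun y : ℝ => ∫ x in I m j ∩ Ioc 0 y, F x) atTop (𝓝 (c j))) (M : ℝ) :
    ∑ j ∈ Finset.Icc 1 (2 ^ m), ‖c j - ∫ x in I m j ∩ Ioc 0 M, F x‖ ^ 2 ≤
      (3 * (C / (1 - θ)) * θ ^ m) ^ 2 := by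
  classical
  set K := C / (1 - θ) * θ ^ m with hK
  have hθ := sub_pos.2 h.lt_one
  have hCK : C ≤ C / (1 - θ) := by
    rw [le_div_iff₀ hθ]
    nlinarith [h.nonneg, h.pos]
  have hCK' : C * θ ^ m ≤ K := mul_le_mul_of_nonneg_right hCK (pow_nonneg h.pos.le _)
  have hC0 : 0 ≤ C * θ ^ m := mul_nonneg h.nonneg (pow_nonneg h.pos.le _)
  have hterm : ∀ j ∈ Finset.Icc 1 (2 ^ m), ‖c j - ∫ x in I m j ∩ Ioc 0 M, F x‖ ^ 2 ≤
      (if BddAbove (I m j) then ‖∫ x in I m j, F x‖ ^ 2 else 0) +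
        (if M ∈ I m j then (2 * K) ^ 2 else 0) + (if ¬ BddAbove (I m j) then (2 * K) ^ 2 else 0) := by
    intro j hj
    have hle : ‖c j - ∫ x in I m j ∩ Ioc 0 M, F x‖ ^ 2 ≤ (2 * K) ^ 2 :=
      pow_le_pow_left₀ (norm_nonneg _) (h.norm_tail_le hI hm hj (hc j hj) M) 2
    have hp : 0 ≤ (2 * K) ^ 2 := sq_nonneg _
    by_cases hb : BddAbove (I m j)
    · have hp' : 0 ≤ ‖∫ x in I m j, F x‖ ^ 2 := sq_nonneg _
      by_cases hM : M ∈ I m j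
      · simp only [hb, hM, if_true, not_true, if_false]
        linarith
      · have := norm_tail_le_of_notMem hI hm hj (hc j hj) hM
        simp only [hb, hM, if_true, not_true, if_false, add_zero]
        rw [← eq_integral_of_bddAbove hI hm hj (hc j hj) hb]
        exact pow_le_pow_left₀ (norm_nonneg _) this 2
    · simp only [hb, if_false, not_false_eq_true, if_true]
      split_ifs <;> linarith
  have hone : ∀ p : ℕ → Prop, ∀ [DecidablePred p],
      (∀ i ∈ Finset.Icc 1 (2 ^ m), ∀ j ∈ Finset.Icc 1 (2 ^ m), p i → p j → i = j) →
      ∑ j ∈ Finset.Icc 1 (2 ^ m), (if p j then (2 * K) ^ 2 else 0) ≤ (2 * K) ^ 2 := by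
    intro p _ hp
    rw [← Finset.sum_filter, Finset.sum_const, nsmul_eq_mul]
    have hcard : (Finset.filter p (Finset.Icc 1 (2 ^ m))).card ≤ 1 := by
      refine Finset.card_le_one.2 fun i hi j hj => ?_
      rw [Finset.mem_filter] at hi hj
      exact hp i hi.1 j hj.1 hi.2 hj.2
    have : ((Finset.filter p (Finset.Icc 1 (2 ^ m))).card : ℝ) ≤ 1 := by exact_mod_cast hcard
    nlinarith [sq_nonneg (2 * K)]
  refine (Finset.sum_le_sum hterm).trans ?_
  rw [Finset.sum_add_distrib, Finset.sum_add_distrib, ← Finset.sum_filter]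
  have h1 := h.squareSum_le m hm
  rw [bddSquareSum] at h1
  have h2 := hone (fun j => M ∈ I m j) fun i hi j hj => hI.eq_of_mem hm hi hj
  have h3 := hone (fun j => ¬ BddAbove (I m j)) fun i hi j hj => hI.eq_of_not_bddAbove hm hi hj
  have h4 : (C * θ ^ m) ^ 2 ≤ K ^ 2 := pow_le_pow_left₀ hC0 hCK' 2
  have h5 : (3 * (C / (1 - θ)) * θ ^ m) ^ 2 = 9 * K ^ 2 := by rw [hK]; ring
  rw [h5]
  nlinarith

/-- Dominated convergence in the sum over levels: each summand tends to `0` because the integrals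
converge, and the summands are dominated by a multiple of `(n + 1) θ ^ (n + 1)`. -/
theorem tendsto_BNorm (h : GeometricDecay I F C θ) (hI : IsMartingaleStructure I) :
    Tendsto (fun M : ℝ => BNorm 1 I ((Ici M).indicator F)) atTop (𝓝 0) := by
  have hex : ∀ m j, ∃ c : ℂ, 1 ≤ m → j ∈ Finset.Icc 1 (2 ^ m) →
      Tendsto (fun y : ℝ => ∫ x in I m j ∩ Ioc 0 y, F x) atTop (𝓝 c) := by
    intro m j
    by_cases hmj : 1 ≤ m ∧ j ∈ Finset.Icc 1 (2 ^ m)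
    · obtain ⟨c, hc⟩ := h.exists_tendsto_integral_inter hI hmj.1 hmj.2
      exact ⟨c, fun _ _ => hc⟩
    · exact ⟨0, fun h1 h2 => absurd ⟨h1, h2⟩ hmj⟩
  choose c hc using hex
  have hB : ∀ M, BNorm 1 I ((Ici M).indicator F) = ∑' n : ℕ, ((n + 1 : ℕ) : ℝ≥0∞) *
      ENNReal.ofReal (√(∑ j ∈ Finset.Icc 1 (2 ^ (n + 1)),
        ‖c (n + 1) j - ∫ x in I (n + 1) j ∩ Ioc 0 M, F x‖ ^ 2)) := by
    intro M
    refine tsum_congr fun n => ?_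
    rw [ENNReal.rpow_one, ← sum_enorm_sq_rpow_half]
    congr 2
    refine Finset.sum_congr rfl fun j hj => ?_
    have := h.hasHalfLineIntegral_indicator (hI.measurableSet (by omega) hj)
      (hc (n + 1) j (by omega) hj) M
    rw [halfLineIntegral, Tendsto.limUnder_eq this]
  simp_rw [hB, ← lintegral_count]
  set K := 3 * (C / (1 - θ)) with hK
  have hK0 : 0 ≤ K := by
    have := sub_pos.2 h.lt_one
    have := h.nonneg
    positivity
  rw [← lintegral_zero (μ := Measure.count (α := ℕ))]
  refine tendsto_lintegral_filter_of_dominated_convergence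
    (fun n : ℕ => ((n + 1 : ℕ) : ℝ≥0∞) * ENNReal.ofReal (K * θ ^ (n + 1)))
    (Eventually.of_forall fun M => measurable_from_nat)
    (Eventually.of_forall fun M => Eventually.of_forall fun n => ?_) ?_
    (Eventually.of_forall fun n => ?_)
  · gcongr
    refine Real.sqrt_le_iff.2 ⟨mul_nonneg hK0 (pow_nonneg h.pos.le _), ?_⟩
    exact h.sum_norm_tail_sq_le hI (by omega) (fun j hj => hc _ j (by omega) hj) M
  · rw [lintegral_count]
    have hs : Summable fun n : ℕ => K * (((n + 1 : ℕ) : ℝ) * θ ^ (n + 1)) := by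
      have := summable_pow_mul_geometric_of_norm_lt_one 1 (r := θ)
        (by rw [Real.norm_of_nonneg h.pos.le]; exact h.lt_one)
      simp only [pow_one] at this
      exact ((summable_nat_add_iff 1).2 this).mul_left K
    have hnn : ∀ n : ℕ, 0 ≤ K * (((n + 1 : ℕ) : ℝ) * θ ^ (n + 1)) := fun n =>
      mul_nonneg hK0 (mul_nonneg (Nat.cast_nonneg _) (pow_nonneg h.pos.le _))
    have heq : ∀ n : ℕ, ((n + 1 : ℕ) : ℝ≥0∞) * ENNReal.ofReal (K * θ ^ (n + 1)) =
        ENNReal.ofReal (K * (((n + 1 : ℕ) : ℝ) * θ ^ (n + 1))) := by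
      intro n
      rw [← ENNReal.ofReal_natCast, ← ENNReal.ofReal_mul (Nat.cast_nonneg _)]
      congr 1; ring
    simp_rw [heq]
    rw [← ENNReal.ofReal_tsum_of_nonneg hnn hs]
    exact ENNReal.ofReal_ne_top
  · have h1 : Tendsto (fun M => ∑ j ∈ Finset.Icc 1 (2 ^ (n + 1)),
        ‖c (n + 1) j - ∫ x in I (n + 1) j ∩ Ioc 0 M, F x‖ ^ 2) atTop
        (𝓝 (∑ j ∈ Finset.Icc 1 (2 ^ (n + 1)), ‖c (n + 1) j - c (n + 1) j‖ ^ 2)) :=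
      tendsto_finsetSum _ fun j hj =>
        ((tendsto_const_nhds.sub (hc (n + 1) j (by omega) hj)).norm.pow 2)
    have h2 := (ENNReal.continuous_ofReal.tendsto _).comp
      ((Real.continuous_sqrt.tendsto _).comp h1)
    have h3 := ENNReal.Tendsto.const_mul (a := ((n + 1 : ℕ) : ℝ≥0∞)) h2
      (Or.inr (ENNReal.natCast_ne_top _))
    simpa using h3

end GeometricDecay

/-! ### An oscillatory integral -/

theorem integral_mul_cexp_eq {a b r : ℝ} (hab : a ≤ b) (hr : r ≠ 0) {u u' : ℝ → ℂ}
    (hu : ∀ k ∈ Icc a b, HasDerivAt u (u' k) k) (hu' : ContinuousOn u' (Icc a b))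
    (ha : u a = 0) (hb : u b = 0) :
    ∫ k in a..b, u k * Complex.exp (-(2 * Complex.I * r) * k) =
      (2 * Complex.I * r)⁻¹ * ∫ k in a..b, u' k * Complex.exp (-(2 * Complex.I * r) * k) := by
  set z : ℂ := -(2 * Complex.I * r) with hz
  have hz0 : z ≠ 0 := by
    simp [hz, hr]
  have hv : ∀ k ∈ uIcc a b, HasDerivAt (fun k : ℝ => z⁻¹ * Complex.exp (z * k))
      (Complex.exp (z * k)) k := by
    intro k _
    have h1 : HasDerivAt (fun k : ℝ => z * (k : ℂ)) (z * 1) k :=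
      (Complex.ofRealCLM.hasDerivAt (x := k)).const_mul z
    convert! (h1.cexp).const_mul z⁻¹ using 1
    field_simp
  rw [intervalIntegral.integral_mul_deriv_eq_deriv_mul (v := fun k : ℝ => z⁻¹ * Complex.exp (z * k))
    (u' := u') (by rwa [uIcc_of_le hab]) hv
    ((by rwa [uIcc_of_le hab] : ContinuousOn u' (uIcc a b)).intervalIntegrable)
    ((by fun_prop : Continuous fun k : ℝ => Complex.exp (z * k)).intervalIntegrable _ _)]
  rw [ha, hb, zero_mul, zero_mul, sub_zero, zero_sub, ← intervalIntegral.integral_neg,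
    ← intervalIntegral.integral_const_mul]
  refine intervalIntegral.integral_congr fun k _ => ?_
  have : (2 * Complex.I * r : ℂ)⁻¹ = - z⁻¹ := by rw [hz, inv_neg, neg_neg]
  simp only [this]
  ring

theorem norm_integral_mul_cexp_le {a b r B : ℝ} (hab : a ≤ b) (hr : r ≠ 0) {u u' u'' : ℝ → ℂ}
    (hu : ∀ k ∈ Icc a b, HasDerivAt u (u' k) k) (hu' : ∀ k ∈ Icc a b, HasDerivAt u' (u'' k) k)
    (hu'' : ContinuousOn u'' (Icc a b)) (ha : u a = 0) (hb : u b = 0) (ha' : u' a = 0)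
    (hb' : u' b = 0) (hB : ∀ k ∈ Icc a b, ‖u'' k‖ ≤ B) :
    r ^ 2 * ‖∫ k in a..b, u k * Complex.exp (-(2 * Complex.I * r) * k)‖ ≤ B * (b - a) := by
  rw [integral_mul_cexp_eq hab hr hu (fun k hk => (hu' k hk).continuousAt.continuousWithinAt) ha hb,
    integral_mul_cexp_eq hab hr hu' hu'' ha' hb']
  have h1 : ‖∫ k in a..b, u'' k * Complex.exp (-(2 * Complex.I * r) * k)‖ ≤ B * |b - a| := by
    refine intervalIntegral.norm_integral_le_of_norm_le_const fun k hk => ?_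
    rw [uIoc_of_le hab] at hk
    have : ‖Complex.exp (-(2 * Complex.I * r) * k)‖ = 1 := by
      rw [show -(2 * Complex.I * r) * (k : ℂ) = ((-2 * r * k : ℝ) : ℂ) * Complex.I by
        push_cast; ring]
      exact Complex.norm_exp_ofReal_mul_I _
    rw [norm_mul, this, mul_one]
    exact hB k ⟨hk.1.le, hk.2⟩
  rw [abs_of_nonneg (sub_nonneg.2 hab)] at h1
  have h2 : ‖(2 * Complex.I * r : ℂ)⁻¹‖ = (2 * |r|)⁻¹ := by simp
  rw [norm_mul, norm_mul, h2]
  have hr' : 0 < |r| := abs_pos.2 hr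
  rw [← sq_abs r]
  set N := ‖∫ k in a..b, u'' k * Complex.exp (-(2 * Complex.I * r) * k)‖
  have hN : 0 ≤ N := norm_nonneg _
  have : |r| ^ 2 * ((2 * |r|)⁻¹ * ((2 * |r|)⁻¹ * N)) = N / 4 := by field_simp; ring
  rw [this]
  linarith

/-- A nonnegative weight that is positive inside `(a, b)` and vanishes to second order at `a` and
`b`, so that integrating twice by parts against it produces no boundary terms. -/
noncomputable def bumpWeight (a b k : ℝ) : ℝ := ((k - a) * (b - k)) ^ 2

theorem bumpWeight_nonneg (a b k : ℝ) : 0 ≤ bumpWeight a b k := sq_nonneg _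

theorem bumpWeight_pos {a b k : ℝ} (hk : k ∈ Ioo a b) : 0 < bumpWeight a b k :=
  pow_pos (mul_pos (sub_pos.2 hk.1) (sub_pos.2 hk.2)) 2

theorem continuous_bumpWeight (a b : ℝ) : Continuous (bumpWeight a b) := by
  unfold bumpWeight; fun_prop

/-- The term `c / k` of the phase is treated as part of the amplitude. Each integration by parts
then costs a factor `1 + |c|` and gains a factor `r`. -/
theorem exists_forall_norm_integral_bumpWeight_le {a b : ℝ} (ha : 0 < a) (hab : a ≤ b) :
    ∃ B : ℝ, 0 ≤ B ∧ ∀ c r : ℝ,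
      ‖∫ k in a..b, (bumpWeight a b k : ℂ) *
        Complex.exp (-(Complex.I * ((2 * k * r - c / k : ℝ) : ℂ)))‖ ≤ B ∧
      r ^ 2 * ‖∫ k in a..b, (bumpWeight a b k : ℂ) *
        Complex.exp (-(Complex.I * ((2 * k * r - c / k : ℝ) : ℂ)))‖ ≤ B * (1 + |c|) ^ 2 := by
  set φ : ℝ → ℂ := fun k => (((k : ℂ) - a) * (b - k)) ^ 2 with hφ
  set φ' : ℝ → ℂ := fun k => 2 * (((k : ℂ) - a) * (b - k)) * (a + b - 2 * k) with hφ'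
  set φ'' : ℝ → ℂ := fun k => 2 * (a + b - 2 * k) ^ 2 - 4 * (((k : ℂ) - a) * (b - k)) with hφ''
  have hφd : ∀ k, HasDerivAt φ (φ' k) k := by
    intro k
    have h1 : HasDerivAt (fun k : ℝ => (k : ℂ)) 1 k := Complex.ofRealCLM.hasDerivAt (x := k)
    convert! ((h1.sub_const (a : ℂ)).mul (h1.const_sub (b : ℂ))).pow 2 using 1
    simp only [hφ', Nat.cast_ofNat, Pi.mul_apply]
    ring
  have hφd' : ∀ k, HasDerivAt φ' (φ'' k) k := by
    intro k
    have h1 : HasDerivAt (fun k : ℝ => (k : ℂ)) 1 k := Complex.ofRealCLM.hasDerivAt (x := k)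
    convert! (((h1.sub_const (a : ℂ)).mul (h1.const_sub (b : ℂ))).const_mul 2).mul
      ((h1.const_mul 2).const_sub ((a : ℂ) + b)) using 1
    simp only [hφ'', Pi.mul_apply]
    ring
  have hpos : ∀ k ∈ Icc a b, (k : ℂ) ≠ 0 := fun k hk =>
    Complex.ofReal_ne_zero.2 (ha.trans_le hk.1).ne'
  set A1 : ℝ → ℂ := fun k => -2 * Complex.I * φ' k / k ^ 2 + 2 * Complex.I * φ k / k ^ 3 with hA1
  set A2 : ℝ → ℂ := fun k => -φ k / k ^ 4 with hA2
  have cofReal : Continuous (fun k : ℝ => (k : ℂ)) := Complex.continuous_ofReal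
  have hφc : Continuous φ := by simp only [hφ]; fun_prop
  have hφ'c : Continuous φ' := by simp only [hφ']; fun_prop
  have hφ''c : Continuous φ'' := by simp only [hφ'']; fun_prop
  have hA1c : ContinuousOn A1 (Icc a b) := by
    refine ContinuousOn.add ?_ ?_
    · exact (by fun_prop : Continuous fun k => -2 * Complex.I * φ' k).continuousOn.div
        (by fun_prop) fun k hk => pow_ne_zero _ (hpos k hk)
    · exact (by fun_prop : Continuous fun k => 2 * Complex.I * φ k).continuousOn.div
        (by fun_prop) fun k hk => pow_ne_zero _ (hpos k hk)
  have hA2c : ContinuousOn A2 (Icc a b) :=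
    hφc.neg.continuousOn.div (by fun_prop) fun k hk => pow_ne_zero _ (hpos k hk)
  obtain ⟨B, hB⟩ := isCompact_Icc.exists_bound_of_continuousOn hφc.continuousOn (s := Icc a b)
  obtain ⟨B0, hB0⟩ := isCompact_Icc.exists_bound_of_continuousOn hφ''c.continuousOn (s := Icc a b)
  obtain ⟨B1, hB1⟩ := isCompact_Icc.exists_bound_of_continuousOn hA1c
  obtain ⟨B2, hB2⟩ := isCompact_Icc.exists_bound_of_continuousOn hA2c
  have hmem : a ∈ Icc a b := ⟨le_rfl, hab⟩
  have hBn := (norm_nonneg _).trans (hB a hmem)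
  have hB0n := (norm_nonneg _).trans (hB0 a hmem)
  have hB1n := (norm_nonneg _).trans (hB1 a hmem)
  have hB2n := (norm_nonneg _).trans (hB2 a hmem)
  have hba : 0 ≤ b - a := sub_nonneg.2 hab
  refine ⟨(B + B0 + B1 + B2) * (b - a), by positivity, fun c r => ?_⟩
  set e : ℝ → ℂ := fun k => Complex.exp (Complex.I * c * (k : ℂ)⁻¹) with he
  have hed : ∀ k ∈ Icc a b, HasDerivAt e (e k * (-(Complex.I * c) / k ^ 2)) k := by
    intro k hk
    have h1 : HasDerivAt (fun k : ℝ => (k : ℂ)) 1 k := Complex.ofRealCLM.hasDerivAt (x := k)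
    convert! ((h1.fun_inv (hpos k hk)).const_mul (Complex.I * c)).cexp using 1
    simp only [he]
    ring
  have hen : ∀ k, ‖e k‖ = 1 := by
    intro k
    simp only [he]
    rw [show Complex.I * c * (k : ℂ)⁻¹ = ((c * k⁻¹ : ℝ) : ℂ) * Complex.I by push_cast; ring]
    exact Complex.norm_exp_ofReal_mul_I _
  have hint : ∀ k : ℝ, (bumpWeight a b k : ℂ) *
      Complex.exp (-(Complex.I * ((2 * k * r - c / k : ℝ) : ℂ))) =
      (φ k * e k) * Complex.exp (-(2 * Complex.I * r) * k) := by
    intro k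
    rw [mul_assoc (φ k), ← Complex.exp_add]
    congr 1
    · simp only [bumpWeight, hφ]; push_cast; rfl
    · congr 1; push_cast; ring
  simp_rw [hint]
  constructor
  · refine (intervalIntegral.norm_integral_le_of_norm_le_const (C := B) fun k hk => ?_).trans ?_
    · rw [uIoc_of_le hab] at hk
      rw [← hint, norm_mul]
      have h1 : ‖Complex.exp (-(Complex.I * ((2 * k * r - c / k : ℝ) : ℂ)))‖ = 1 := by
        rw [show -(Complex.I * ((2 * k * r - c / k : ℝ) : ℂ)) =
          ((-(2 * k * r - c / k) : ℝ) : ℂ) * Complex.I by push_cast; ring]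
        exact Complex.norm_exp_ofReal_mul_I _
      rw [h1, mul_one]
      have := hB k ⟨hk.1.le, hk.2⟩
      simp only [hφ] at this
      simpa [bumpWeight] using this
    · rw [abs_of_nonneg hba]
      exact mul_le_mul_of_nonneg_right (by linarith) hba
  · by_cases hr : r = 0
    · rw [hr]; simp only [ne_eq, OfNat.ofNat_ne_zero, not_false_eq_true, zero_pow, zero_mul]
      positivity
    have hk0 : ∀ k ∈ Icc a b, HasDerivAt (fun k => φ k * e k)
        ((φ' k - Complex.I * c * φ k / k ^ 2) * e k) k := by
      intro k hk
      convert! (hφd k).mul (hed k hk) using 1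
      ring
    have hk1 : ∀ k ∈ Icc a b, HasDerivAt (fun k => (φ' k - Complex.I * c * φ k / k ^ 2) * e k)
        ((φ'' k + c * A1 k + c ^ 2 * A2 k) * e k) k := by
      intro k hk
      have h1 : HasDerivAt (fun k : ℝ => (k : ℂ)) 1 k := Complex.ofRealCLM.hasDerivAt (x := k)
      have hk' := hpos k hk
      convert! ((hφd' k).sub (((hφd k).const_mul (Complex.I * c)).div (h1.pow 2)
        (pow_ne_zero _ hk'))).mul (hed k hk) using 1
      simp only [hA1, hA2, Pi.pow_apply, Pi.sub_apply, Pi.div_apply]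
      field_simp
      ring_nf
      simp only [Complex.I_sq]
      ring
    have hec : ContinuousOn e (Icc a b) := fun k hk =>
      (hed k hk).continuousAt.continuousWithinAt
    refine (norm_integral_mul_cexp_le (B := (B0 + B1 + B2) * (1 + |c|) ^ 2) hab hr hk0 hk1
      (((hφ''c.continuousOn.add (continuousOn_const.mul hA1c)).add
        (continuousOn_const.mul hA2c)).mul hec)
      (by simp [hφ]) (by simp [hφ]) (by simp [hφ, hφ']) (by simp [hφ, hφ']) ?_).trans ?_
    · intro k hk
      rw [norm_mul, hen, mul_one]
      have h1 : ‖φ'' k + c * A1 k + c ^ 2 * A2 k‖ ≤ B0 + |c| * B1 + |c| ^ 2 * B2 := by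
        refine (norm_add_le _ _).trans (add_le_add ((norm_add_le _ _).trans
          (add_le_add (hB0 k hk) ?_)) ?_)
        · rw [norm_mul, Complex.norm_real, Real.norm_eq_abs]
          exact mul_le_mul_of_nonneg_left (hB1 k hk) (abs_nonneg _)
        · rw [norm_mul, norm_pow, Complex.norm_real, Real.norm_eq_abs]
          exact mul_le_mul_of_nonneg_left (hB2 k hk) (by positivity)
      refine h1.trans ?_
      have hc := abs_nonneg c
      nlinarith [mul_nonneg hB0n hc, mul_nonneg hB1n hc, mul_nonneg hB2n hc,
        mul_nonneg hB0n (sq_nonneg |c|), mul_nonneg hB1n (sq_nonneg |c|)]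
    · have : 0 ≤ B * (b - a) * (1 + |c|) ^ 2 := by positivity
      nlinarith

/-- If `c` grows at most like `|r| ^ s` with `s < 1/2`, the oscillatory integral decays at an
integrable rate in `r`. -/
theorem exists_forall_norm_integral_bumpWeight_le_rpow {a b D s : ℝ} (ha : 0 < a) (hab : a ≤ b)
    (hD : 0 ≤ D) (hs0 : 0 ≤ s) :
    ∃ B : ℝ, 0 ≤ B ∧ ∀ c r : ℝ, |c| ≤ D * (1 + |r|) ^ s →
      ‖∫ k in a..b, (bumpWeight a b k : ℂ) *
        Complex.exp (-(Complex.I * ((2 * k * r - c / k : ℝ) : ℂ)))‖ ≤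
        B * (1 + |r|) ^ (-(2 - 2 * s)) := by
  obtain ⟨B, hB0, hB⟩ := exists_forall_norm_integral_bumpWeight_le ha hab
  refine ⟨4 * B * (1 + D) ^ 2, by positivity, fun c r hc => ?_⟩
  obtain ⟨h1, h2⟩ := hB c r
  set N := ‖∫ k in a..b, (bumpWeight a b k : ℂ) *
        Complex.exp (-(Complex.I * ((2 * k * r - c / k : ℝ) : ℂ)))‖
  have hN : 0 ≤ N := norm_nonneg _
  set X := 1 + |r| with hX
  have hX1 : 1 ≤ X := by have := abs_nonneg r; linarith
  have hX0 : 0 < X := by linarith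
  have hXs : 1 ≤ X ^ s := Real.one_le_rpow hX1 hs0
  rw [Real.rpow_neg hX0.le, ← div_eq_mul_inv, le_div_iff₀ (Real.rpow_pos_of_pos hX0 _)]
  have hsplit : X ^ (2 - 2 * s) * (X ^ s) ^ 2 = X ^ 2 := by
    rw [← Real.rpow_natCast, ← Real.rpow_mul hX0.le, ← Real.rpow_add hX0, ← Real.rpow_natCast]
    congr 1; push_cast; ring
  have hZ0 : 0 < X ^ (2 - 2 * s) := Real.rpow_pos_of_pos hX0 _
  rcases le_or_gt 1 |r| with hr | hr
  · have hX2 : X ^ 2 ≤ 4 * r ^ 2 := by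
      rw [← sq_abs r]; nlinarith
    have hc2 : (1 + |c|) ^ 2 ≤ (1 + D) ^ 2 * (X ^ s) ^ 2 := by
      rw [← mul_pow]
      refine pow_le_pow_left₀ (by positivity) ?_ 2
      nlinarith
    have hpos : 0 < (X ^ s) ^ 2 := by positivity
    refine le_of_mul_le_mul_right ?_ hpos
    calc N * X ^ (2 - 2 * s) * (X ^ s) ^ 2 = N * X ^ 2 := by rw [mul_assoc, hsplit]
      _ ≤ N * (4 * r ^ 2) := by gcongr
      _ = 4 * (r ^ 2 * N) := by ring
      _ ≤ 4 * (B * (1 + |c|) ^ 2) := by gcongr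
      _ ≤ 4 * (B * ((1 + D) ^ 2 * (X ^ s) ^ 2)) := by gcongr
      _ = _ := by ring
  · have hX2 : X ^ (2 - 2 * s) ≤ 4 := by
      have : X ^ (2 - 2 * s) ≤ X ^ (2 : ℝ) := Real.rpow_le_rpow_of_exponent_le hX1 (by linarith)
      rw [Real.rpow_two] at this
      nlinarith
    have hD1 : 1 ≤ (1 + D) ^ 2 := by nlinarith
    calc N * X ^ (2 - 2 * s) ≤ B * 4 := mul_le_mul h1 hX2 hZ0.le hB0
      _ ≤ 4 * B * (1 + D) ^ 2 := by nlinarith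

/-! ### Unit cells of the half-line -/

/-- The `L¹` norm `∫_i^{i+1} |g|` of `g` on the `i`-th unit cell of the half-line. -/
noncomputable def cellNorm (g : ℝ → ℝ) (i : ℕ) : ℝ≥0∞ :=
  ∫⁻ x in Ioc (i : ℝ) ((i : ℝ) + 1), ‖g x‖ₑ

theorem pairwise_disjoint_cells :
    Pairwise (Function.onFun Disjoint fun i : ℕ => Ioc (i : ℝ) ((i : ℝ) + 1)) := by
  simpa using (Nat.mono_cast (α := ℝ)).pairwise_disjoint_on_Ioc_succ

theorem iUnion_cells : ⋃ i : ℕ, Ioc (i : ℝ) ((i : ℝ) + 1) = Ioi 0 := by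
  have := iUnion_Ioc_map_succ_eq_Ioi (f := fun n : ℕ => (n : ℝ)) (fun a => by simp) (by
    rintro ⟨B, hB⟩
    obtain ⟨n, hn⟩ := exists_nat_gt B
    exact absurd (hB ⟨n, rfl⟩) (not_le.2 hn))
  simpa using this

theorem lintegral_Ioi_zero_eq_tsum (f : ℝ → ℝ≥0∞) :
    ∫⁻ x in Ioi 0, f x = ∑' i : ℕ, ∫⁻ x in Ioc (i : ℝ) ((i : ℝ) + 1), f x := by
  rw [← iUnion_cells, lintegral_iUnion (fun _ => measurableSet_Ioc) pairwise_disjoint_cells]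

theorem cell_subset_Ioi (i : ℕ) : Ioc (i : ℝ) ((i : ℝ) + 1) ⊆ Ioi 0 := fun _ hx =>
  (Nat.cast_nonneg i).trans_lt hx.1

theorem cellNorm_mono {f g : ℝ → ℝ} (h : ∀ x, |f x| ≤ |g x|) (i : ℕ) :
    cellNorm f i ≤ cellNorm g i := by
  refine lintegral_mono fun x => ?_
  rw [Real.enorm_eq_ofReal_abs, Real.enorm_eq_ofReal_abs]
  exact ENNReal.ofReal_le_ofReal (h x)

/-! ### A square function estimate -/

theorem tsum_int_one_add_abs_rpow_ne_top {s : ℝ} (hs : 1 < s) :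
    ∑' z : ℤ, ENNReal.ofReal ((1 + |(z : ℝ)|) ^ (-s)) ≠ ∞ := by
  have hnn : ∀ z : ℤ, 0 ≤ (1 + |(z : ℝ)|) ^ (-s) := fun z => by positivity
  have hnat : Summable fun n : ℕ => (1 + (n : ℝ)) ^ (-s) := by
    have := (summable_nat_add_iff 1).2 (Real.summable_nat_rpow.2 (neg_lt_neg hs))
    refine this.congr fun n => ?_
    push_cast; rw [add_comm]
  have : Summable fun z : ℤ => (1 + |(z : ℝ)|) ^ (-s) := by
    refine Summable.of_nat_of_neg ?_ ?_
    · simpa using hnat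
    · simpa using hnat
  rw [← ENNReal.ofReal_tsum_of_nonneg hnn this]
  exact ENNReal.ofReal_ne_top

theorem ENNReal.mul_le_sq_add_sq (a b : ℝ≥0∞) : a * b ≤ a ^ 2 + b ^ 2 := by
  rcases le_total a b with h | h
  · exact (mul_le_mul_left h b).trans (by rw [← sq]; exact le_add_self)
  · exact (mul_le_mul_right h a).trans (by rw [← sq]; exact le_self_add)

/-- Schur's test for a translation invariant kernel on `ℕ`. -/
theorem tsum_tsum_mul_sub_le (a : ℕ → ℝ≥0∞) (w : ℤ → ℝ≥0∞) :
    ∑' i, ∑' j, a i * a j * w ((i : ℤ) - j) ≤ 2 * (∑' z, w z) * ∑' i, a i ^ 2 := by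
  have hrow : ∀ i : ℕ, ∑' j : ℕ, w ((i : ℤ) - j) ≤ ∑' z, w z := fun i =>
    ENNReal.tsum_comp_le_tsum_of_injective (f := fun j : ℕ => (i : ℤ) - j)
      (fun x y hxy => by simpa using hxy) w
  have hcol : ∀ j : ℕ, ∑' i : ℕ, w ((i : ℤ) - j) ≤ ∑' z, w z := fun j =>
    ENNReal.tsum_comp_le_tsum_of_injective (f := fun i : ℕ => (i : ℤ) - j)
      (fun x y hxy => by simpa using hxy) w
  calc ∑' i, ∑' j, a i * a j * w ((i : ℤ) - j)
      ≤ ∑' i, ∑' j : ℕ, (a i ^ 2 * w ((i : ℤ) - j) + a j ^ 2 * w ((i : ℤ) - j)) := by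
        refine ENNReal.tsum_le_tsum fun i => ENNReal.tsum_le_tsum fun j => ?_
        rw [← add_mul]
        exact mul_le_mul_left (ENNReal.mul_le_sq_add_sq _ _) _
    _ = ∑' i, ∑' j : ℕ, a i ^ 2 * w ((i : ℤ) - j) + ∑' j, ∑' i : ℕ, a j ^ 2 * w ((i : ℤ) - j) := by
        simp_rw [ENNReal.tsum_add]
        congr 1
        exact ENNReal.tsum_comm
    _ ≤ ∑' i, a i ^ 2 * (∑' z, w z) + ∑' j, a j ^ 2 * (∑' z, w z) := by
        simp_rw [ENNReal.tsum_mul_left]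
        exact add_le_add (ENNReal.tsum_le_tsum fun i => mul_le_mul_right (hrow i) _)
          (ENNReal.tsum_le_tsum fun j => mul_le_mul_right (hcol j) _)
    _ = _ := by rw [ENNReal.tsum_mul_right]; ring

/-- A bilinear form on the half-line whose kernel decays at an integrable rate off the diagonal is
bounded on the space of functions whose `L¹` norms on unit cells are square summable. -/
theorem lintegral_lintegral_mul_kernel_le {g : ℝ → ℝ}
    (hg : AEMeasurable g (volume.restrict (Ioi 0))) {s : ℝ} (hs : 0 ≤ s) {K : ℝ → ℝ → ℝ≥0∞} {B : ℝ}
    (hK : ∀ x ∈ Ioi (0 : ℝ), ∀ y ∈ Ioi (0 : ℝ),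
      K x y ≤ ENNReal.ofReal (B * (1 + |x - y|) ^ (-s))) :
    ∫⁻ x in Ioi 0, ∫⁻ y in Ioi 0, ‖g x‖ₑ * ‖g y‖ₑ * K x y ≤
      2 * (∑' z : ℤ, ENNReal.ofReal (B * 2 ^ s) * ENNReal.ofReal ((1 + |(z : ℝ)|) ^ (-s))) *
        ∑' i, cellNorm g i ^ 2 := by
  set w : ℤ → ℝ≥0∞ := fun z =>
    ENNReal.ofReal (B * 2 ^ s) * ENNReal.ofReal ((1 + |(z : ℝ)|) ^ (-s)) with hw
  have hg' : ∀ i : ℕ, AEMeasurable (fun x => ‖g x‖ₑ)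
      (volume.restrict (Ioc (i : ℝ) ((i : ℝ) + 1))) := fun i =>
    (hg.mono_measure (Measure.restrict_mono_set _ (cell_subset_Ioi i))).enorm
  have hcell : ∀ i j : ℕ, ∀ x ∈ Ioc (i : ℝ) ((i : ℝ) + 1), ∀ y ∈ Ioc (j : ℝ) ((j : ℝ) + 1),
      K x y ≤ w ((i : ℤ) - j) := by
    intro i j x hx y hy
    refine (hK x (cell_subset_Ioi i hx) y (cell_subset_Ioi j hy)).trans ?_
    have hpos : 0 < 1 + |x - y| := by positivity
    have hz : 0 < 1 + |(((i : ℤ) - j : ℤ) : ℝ)| := by positivity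
    rcases le_or_gt B 0 with hB | hB
    · rw [ENNReal.ofReal_of_nonpos (mul_nonpos_of_nonpos_of_nonneg hB (by positivity))]
      exact zero_le
    rw [hw]
    simp only
    rw [← ENNReal.ofReal_mul (by positivity)]
    refine ENNReal.ofReal_le_ofReal ?_
    rw [mul_assoc]
    refine mul_le_mul_of_nonneg_left ?_ hB.le
    have hle : (1 + |(((i : ℤ) - j : ℤ) : ℝ)|) / 2 ≤ 1 + |x - y| := by
      push_cast
      have h1 : |(i : ℝ) - j| ≤ |x - y| + 1 := by
        rw [abs_le]
        obtain ⟨h2, h3⟩ := hx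
        obtain ⟨h4, h5⟩ := hy
        have := le_abs_self (x - y)
        have := neg_abs_le (x - y)
        constructor <;> linarith
      have := abs_nonneg (x - y)
      linarith
    calc (1 + |x - y|) ^ (-s) ≤ ((1 + |(((i : ℤ) - j : ℤ) : ℝ)|) / 2) ^ (-s) :=
          Real.rpow_le_rpow_of_nonpos (by positivity) hle (neg_nonpos.2 hs)
      _ = 2 ^ s * (1 + |(((i : ℤ) - j : ℤ) : ℝ)|) ^ (-s) := by
          rw [Real.div_rpow hz.le (by norm_num), Real.rpow_neg (x := 2) (by norm_num), div_inv_eq_mul,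
            mul_comm]
  refine le_trans ?_ (tsum_tsum_mul_sub_le (cellNorm g) w)
  rw [lintegral_Ioi_zero_eq_tsum]
  refine ENNReal.tsum_le_tsum fun i => ?_
  have hinner : ∀ x ∈ Ioc (i : ℝ) ((i : ℝ) + 1), ∫⁻ y in Ioi 0, ‖g x‖ₑ * ‖g y‖ₑ * K x y ≤
      ‖g x‖ₑ * ∑' j : ℕ, cellNorm g j * w ((i : ℤ) - j) := by
    intro x hx
    rw [lintegral_Ioi_zero_eq_tsum, ← ENNReal.tsum_mul_left]
    refine ENNReal.tsum_le_tsum fun j => ?_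
    calc ∫⁻ y in Ioc (j : ℝ) ((j : ℝ) + 1), ‖g x‖ₑ * ‖g y‖ₑ * K x y
        ≤ ∫⁻ y in Ioc (j : ℝ) ((j : ℝ) + 1), (‖g x‖ₑ * w ((i : ℤ) - j)) * ‖g y‖ₑ := by
          refine setLIntegral_mono' measurableSet_Ioc fun y hy => ?_
          rw [mul_right_comm]
          gcongr
          exact hcell i j x hx y hy
      _ = ‖g x‖ₑ * (cellNorm g j * w ((i : ℤ) - j)) := by
          rw [lintegral_const_mul'' _ (hg' j), cellNorm]; ring
  refine (setLIntegral_mono' measurableSet_Ioc hinner).trans ?_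
  rw [lintegral_mul_const'' _ (hg' i), ← cellNorm, ← ENNReal.tsum_mul_left]
  simp_rw [mul_assoc]
  exact le_rfl

/-- Expanding the square: the weighted `L²` norm of `k ↦ ∫ e(k, x) g(x) dx` is a bilinear form in
`g`. -/
theorem lintegral_mul_enorm_integral_sq_le {α β : Type*} [MeasurableSpace α] [MeasurableSpace β]
    {μ : Measure α} {ν : Measure β} [SFinite μ] [SFinite ν] {φ : α → ℝ} (hφ0 : ∀ k, 0 ≤ φ k)
    (hφ : Integrable φ μ) {e : α → β → ℂ} (he : Measurable (Function.uncurry e))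
    (he1 : ∀ k x, ‖e k x‖ ≤ 1) {g : β → ℂ} (hg : Integrable g ν) :
    ∫⁻ k, ENNReal.ofReal (φ k) * ‖∫ x, e k x * g x ∂ν‖ₑ ^ 2 ∂μ ≤
      ∫⁻ z, ‖g z.1‖ₑ * ‖g z.2‖ₑ *
        ‖∫ k, (φ k : ℂ) * (e k z.1 * (starRingEnd ℂ) (e k z.2)) ∂μ‖ₑ ∂(ν.prod ν) := by
  set H : α → β × β → ℂ := fun k z =>
    (e k z.1 * (starRingEnd ℂ) (e k z.2)) * ((φ k : ℂ) * (g z.1 * (starRingEnd ℂ) (g z.2))) with hH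
  have hgc : Integrable (fun x => (starRingEnd ℂ) (g x)) ν :=
    Complex.conjCLE.toContinuousLinearMap.integrable_comp hg
  have hme : Measurable fun w : α × (β × β) =>
      e w.1 w.2.1 * (starRingEnd ℂ) (e w.1 w.2.2) := by
    have h1 : Measurable fun w : α × (β × β) => e w.1 w.2.1 :=
      he.comp (measurable_fst.prodMk (measurable_fst.comp measurable_snd))
    have h2 : Measurable fun w : α × (β × β) => e w.1 w.2.2 :=
      he.comp (measurable_fst.prodMk (measurable_snd.comp measurable_snd))
    exact h1.mul (Complex.continuous_conj.measurable.comp h2)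
  have hint : Integrable (Function.uncurry H) (μ.prod (ν.prod ν)) := by
    have h1 : Integrable (fun w : α × (β × β) =>
        (φ w.1 : ℂ) * (g w.2.1 * (starRingEnd ℂ) (g w.2.2))) (μ.prod (ν.prod ν)) :=
      hφ.ofReal.mul_prod (hg.mul_prod hgc)
    refine h1.bdd_mul (c := 1) hme.aestronglyMeasurable (Eventually.of_forall fun w => ?_)
    rw [norm_mul, RCLike.norm_conj]
    exact mul_le_one₀ (he1 _ _) (norm_nonneg _) (he1 _ _)
  have hsq : ∀ k, ((φ k * ‖∫ x, e k x * g x ∂ν‖ ^ 2 : ℝ) : ℂ) = ∫ z, H k z ∂(ν.prod ν) := by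
    intro k
    have h1 : ∫ z, H k z ∂(ν.prod ν) = (φ k : ℂ) * ((∫ x, e k x * g x ∂ν) *
        ∫ x, (starRingEnd ℂ) (e k x * g x) ∂ν) := by
      rw [← integral_prod_mul, ← integral_const_mul]
      refine integral_congr_ae (Eventually.of_forall fun z => ?_)
      simp only [hH, map_mul]
      ring
    rw [h1, integral_conj, Complex.mul_conj, Complex.normSq_eq_norm_sq]
    push_cast
    ring
  have hsqint : Integrable (fun k => φ k * ‖∫ x, e k x * g x ∂ν‖ ^ 2) μ := by
    have h1 := hint.integral_prod_left
    simp only [Function.uncurry_apply_pair] at h1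
    simp_rw [← hsq] at h1
    exact h1.re
  calc ∫⁻ k, ENNReal.ofReal (φ k) * ‖∫ x, e k x * g x ∂ν‖ₑ ^ 2 ∂μ
      = ∫⁻ k, ENNReal.ofReal (φ k * ‖∫ x, e k x * g x ∂ν‖ ^ 2) ∂μ := by
        refine lintegral_congr fun k => ?_
        rw [ENNReal.ofReal_mul (hφ0 k), ENNReal.ofReal_pow (norm_nonneg _), ofReal_norm]
    _ = ENNReal.ofReal (∫ k, φ k * ‖∫ x, e k x * g x ∂ν‖ ^ 2 ∂μ) :=
        (ofReal_integral_eq_lintegral_ofReal hsqint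
          (Eventually.of_forall fun k => mul_nonneg (hφ0 k) (sq_nonneg _))).symm
    _ ≤ ‖∫ z, ∫ k, H k z ∂μ ∂(ν.prod ν)‖ₑ := by
        rw [← integral_integral_swap hint]
        simp_rw [← hsq]
        rw [integral_complex_ofReal, ← ofReal_norm, Complex.norm_real]
        exact ENNReal.ofReal_le_ofReal (le_abs_self _)
    _ ≤ ∫⁻ z, ‖∫ k, H k z ∂μ‖ₑ ∂(ν.prod ν) := enorm_integral_le_lintegral_enorm _
    _ = _ := by
        refine lintegral_congr fun z => ?_
        have : ∫ k, H k z ∂μ = (g z.1 * (starRingEnd ℂ) (g z.2)) *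
            ∫ k, (φ k : ℂ) * (e k z.1 * (starRingEnd ℂ) (e k z.2)) ∂μ := by
          rw [← integral_const_mul]
          refine integral_congr_ae (Eventually.of_forall fun k => ?_)
          simp only [hH]
          ring
        rw [this, enorm_mul, enorm_mul]
        congr 2
        rw [← ofReal_norm, RCLike.norm_conj, ofReal_norm]

/-- The oscillating factor `exp (-i (2 k x - P(x) / k))`. -/
noncomputable def phaseFactor (P : ℝ → ℝ) (k x : ℝ) : ℂ :=
  Complex.exp (-(Complex.I * ((2 * k * x - P x / k : ℝ) : ℂ)))

theorem norm_phaseFactor (P : ℝ → ℝ) (k x : ℝ) : ‖phaseFactor P k x‖ = 1 := by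
  rw [phaseFactor, show -(Complex.I * ((2 * k * x - P x / k : ℝ) : ℂ)) =
    ((-(2 * k * x - P x / k) : ℝ) : ℂ) * Complex.I by push_cast; ring]
  exact Complex.norm_exp_ofReal_mul_I _

theorem measurable_phaseFactor {P : ℝ → ℝ} (hP : Measurable P) :
    Measurable (Function.uncurry (phaseFactor P)) := by
  have : Measurable fun w : ℝ × ℝ => 2 * w.1 * w.2 - P w.2 / w.1 :=
    ((measurable_const.mul measurable_fst).mul measurable_snd).sub
      ((hP.comp measurable_snd).div measurable_fst)
  exact Complex.continuous_exp.measurable.comp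
    ((measurable_const.mul (Complex.measurable_ofReal.comp this)).neg)

theorem phaseFactor_mul_conj (P : ℝ → ℝ) (k x y : ℝ) :
    phaseFactor P k x * (starRingEnd ℂ) (phaseFactor P k y) =
      Complex.exp (-(Complex.I * ((2 * k * (x - y) - (P x - P y) / k : ℝ) : ℂ))) := by
  rw [phaseFactor, phaseFactor, ← Complex.exp_conj, ← Complex.exp_add]
  congr 1
  simp only [map_neg, map_mul, Complex.conj_I, Complex.conj_ofReal]
  push_cast
  ring

/-- The oscillatory transform `g ↦ ∫ exp (-i (2 k x - P(x) / k)) g(x) dx` on the half-line. -/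
noncomputable def oscTransform (P : ℝ → ℝ) (g : ℝ → ℝ) (k : ℝ) : ℂ :=
  ∫ x in Ioi 0, phaseFactor P k x * (g x : ℂ)

/-- The `L²` estimate for the oscillatory transform. The growth exponent `s < 1/2` of `P` is what
makes the kernel of the squared transform integrable off the diagonal. -/
theorem exists_forall_lintegral_oscTransform_le {a b D s : ℝ} (ha : 0 < a) (hab : a ≤ b)
    (hD : 0 ≤ D) (hs0 : 0 ≤ s) (hs1 : s < 1 / 2) {P : ℝ → ℝ} (hP : Measurable P)
    (hPD : ∀ x ∈ Ioi (0 : ℝ), ∀ y ∈ Ioi (0 : ℝ), |P x - P y| ≤ D * (1 + |x - y|) ^ s) :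
    ∃ C : ℝ≥0∞, C ≠ ∞ ∧ ∀ g : ℝ → ℝ, IntegrableOn g (Ioi 0) →
      ∫⁻ k in Ioc a b, ENNReal.ofReal (bumpWeight a b k) * ‖oscTransform P g k‖ₑ ^ 2 ≤
        C * ∑' i, cellNorm g i ^ 2 := by
  obtain ⟨B, hB0, hB⟩ := exists_forall_norm_integral_bumpWeight_le_rpow ha hab hD hs0
  refine ⟨2 * (∑' z : ℤ, ENNReal.ofReal (B * 2 ^ (2 - 2 * s)) *
    ENNReal.ofReal ((1 + |(z : ℝ)|) ^ (-(2 - 2 * s)))), ?_, fun g hg => ?_⟩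
  · rw [ENNReal.tsum_mul_left]
    exact ENNReal.mul_ne_top (by norm_num) (ENNReal.mul_ne_top ENNReal.ofReal_ne_top
      (tsum_int_one_add_abs_rpow_ne_top (by linarith)))
  have hφ : Integrable (bumpWeight a b) (volume.restrict (Ioc a b)) :=
    ((continuous_bumpWeight a b).integrableOn_Icc).mono_set Ioc_subset_Icc_self
  have hgc : Integrable (fun x => (g x : ℂ)) (volume.restrict (Ioi 0)) := hg.ofReal
  refine (lintegral_mul_enorm_integral_sq_le (bumpWeight_nonneg a b) hφ (measurable_phaseFactor hP)
    (fun k x => (norm_phaseFactor P k x).le) hgc).trans ?_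
  set K : ℝ → ℝ → ℝ≥0∞ := fun x y => ‖∫ k in Ioc a b, (bumpWeight a b k : ℂ) *
    (phaseFactor P k x * (starRingEnd ℂ) (phaseFactor P k y))‖ₑ with hK
  refine (lintegral_prod_le _).trans ?_
  have := lintegral_lintegral_mul_kernel_le (g := g) hg.aestronglyMeasurable.aemeasurable
    (s := 2 - 2 * s) (by linarith) (K := K) (B := B) (fun x hx y hy => ?_)
  · simpa only [← ofReal_norm, Complex.norm_real, hK] using this
  · rw [hK]
    simp only
    rw [← ofReal_norm]
    refine ENNReal.ofReal_le_ofReal ?_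
    simp_rw [phaseFactor_mul_conj]
    rw [← intervalIntegral.integral_of_le hab]
    exact hB (P x - P y) (x - y) (hPD x hx y hy)

/-! ### The amalgam spaces -/

theorem tsum_cellNorm_rpow {p : ℝ} (hp : 0 < p) (f : ℝ → ℝ) :
    ∑' i, cellNorm f i ^ p = lpL1Norm p f ^ p := by
  rw [lpL1Norm, ← ENNReal.rpow_mul, one_div, inv_mul_cancel₀ hp.ne', ENNReal.rpow_one]
  rfl

theorem cellNorm_le_lpL1Norm {p : ℝ} (hp : 0 < p) (f : ℝ → ℝ) (i : ℕ) :
    cellNorm f i ≤ lpL1Norm p f := by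
  rw [← ENNReal.rpow_le_rpow_iff hp, ← tsum_cellNorm_rpow hp]
  exact ENNReal.le_tsum i

theorem lpL1Norm_mono {p : ℝ} (hp : 0 < p) {f g : ℝ → ℝ} (h : ∀ x, |f x| ≤ |g x|) :
    lpL1Norm p f ≤ lpL1Norm p g := by
  rw [← ENNReal.rpow_le_rpow_iff hp, ← tsum_cellNorm_rpow hp, ← tsum_cellNorm_rpow hp]
  exact ENNReal.tsum_le_tsum fun i => ENNReal.rpow_le_rpow (cellNorm_mono h i) hp.le

/-- The inclusion of `ℓ^p(L¹)` in `ℓ²(L¹)`. -/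
theorem tsum_cellNorm_sq_le {p : ℝ} (hp : 0 < p) (hp2 : p ≤ 2) (f : ℝ → ℝ) :
    ∑' i, cellNorm f i ^ 2 ≤ lpL1Norm p f ^ 2 := by
  have hsplit : ∀ a : ℝ≥0∞, a ^ 2 = a ^ p * a ^ (2 - p) := by
    intro a
    rw [← ENNReal.rpow_add_of_nonneg _ _ hp.le (sub_nonneg.2 hp2), ← ENNReal.rpow_two]
    congr 1; ring
  calc ∑' i, cellNorm f i ^ 2 ≤ ∑' i, cellNorm f i ^ p * lpL1Norm p f ^ (2 - p) := by
        refine ENNReal.tsum_le_tsum fun i => ?_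
        rw [hsplit]
        gcongr
        exact cellNorm_le_lpL1Norm hp f i
    _ = lpL1Norm p f ^ 2 := by rw [ENNReal.tsum_mul_right, tsum_cellNorm_rpow hp, ← hsplit]

theorem Ioc_subset_iUnion_cells {x y : ℝ} (hy : 0 ≤ y) :
    Ioc y x ⊆ ⋃ i ∈ Finset.Icc ⌊y⌋₊ ⌊x⌋₊, Ioc (i : ℝ) ((i : ℝ) + 1) := by
  intro t ht
  have ht0 : 0 < t := hy.trans_lt ht.1
  have : t ∈ ⋃ i : ℕ, Ioc (i : ℝ) ((i : ℝ) + 1) := by rw [iUnion_cells]; exact ht0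
  obtain ⟨i, hi⟩ := mem_iUnion.1 this
  refine mem_biUnion (x := i) ?_ hi
  rw [Finset.coe_Icc]
  constructor
  · have h1 := Nat.floor_le hy
    have h2 : (⌊y⌋₊ : ℝ) < ((i + 1 : ℕ) : ℝ) := by
      push_cast; linarith [ht.1, hi.2]
    exact Nat.lt_succ_iff.1 (Nat.cast_lt.1 h2)
  · exact Nat.le_floor (hi.1.le.trans ht.2)

/-- Hölder's inequality over the unit cells that meet `(y, x]`. -/
theorem lintegral_Ioc_le {p : ℝ} (hp : 1 ≤ p) (g : ℝ → ℝ) {x y : ℝ} (hy : 0 ≤ y) (hyx : y ≤ x) :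
    ∫⁻ t in Ioc y x, ‖g t‖ₑ ≤
      ENNReal.ofReal (2 * (1 + |x - y|)) ^ (1 - 1 / p) * lpL1Norm p g := by
  have hp0 : 0 < p := by linarith
  set s := Finset.Icc ⌊y⌋₊ ⌊x⌋₊ with hs
  have h1 : ∫⁻ t in Ioc y x, ‖g t‖ₑ ≤ ∑ i ∈ s, cellNorm g i := by
    refine (lintegral_mono_set (Ioc_subset_iUnion_cells hy)).trans (le_of_eq ?_)
    exact lintegral_biUnion_finset (fun i _ j _ hij => pairwise_disjoint_cells hij)
      (fun _ _ => measurableSet_Ioc) _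
  refine h1.trans ?_
  have hcard : (s.card : ℝ≥0∞) ≤ ENNReal.ofReal (2 * (1 + |x - y|)) := by
    rw [← ENNReal.ofReal_natCast]
    refine ENNReal.ofReal_le_ofReal ?_
    have hfl : ⌊y⌋₊ ≤ ⌊x⌋₊ := Nat.floor_mono hyx
    rw [hs, Nat.card_Icc, Nat.cast_sub (by omega)]
    push_cast
    have h2 := Nat.floor_le (hy.trans hyx)
    have h3 := Nat.lt_floor_add_one y
    have h4 := le_abs_self (x - y)
    have h5 := abs_nonneg (x - y)
    linarith
  rw [← ENNReal.rpow_le_rpow_iff hp0, ENNReal.mul_rpow_of_nonneg _ _ hp0.le, ← ENNReal.rpow_mul,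
    ← tsum_cellNorm_rpow hp0]
  refine (ENNReal.rpow_sum_le_const_mul_sum_rpow s (cellNorm g) hp).trans ?_
  have hexp : (1 - 1 / p) * p = p - 1 := by field_simp
  rw [hexp]
  gcongr
  exact ENNReal.sum_le_tsum s

theorem lintegral_Ioc_zero_le {p : ℝ} (hp : 1 ≤ p) (g : ℝ → ℝ) (y : ℝ) :
    ∫⁻ t in Ioc 0 y, ‖g t‖ₑ ≤ ENNReal.ofReal (2 * (1 + |y|)) ^ (1 - 1 / p) * lpL1Norm p g := by
  rcases le_or_gt 0 y with hy | hy
  · simpa using lintegral_Ioc_le hp g le_rfl hy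
  · simp [Ioc_eq_empty (not_lt.2 hy.le)]

theorem MemLpL1.integrableOn {p : ℝ} (hp : 1 ≤ p) {g : ℝ → ℝ} (hg : MemLpL1 p g) (y : ℝ) :
    IntegrableOn g (Ioc 0 y) := by
  refine ⟨hg.1.mono_measure (Measure.restrict_mono_set _ Ioc_subset_Ioi_self), ?_⟩
  have hexp : 0 ≤ 1 - 1 / p := sub_nonneg.2 ((div_le_one (by linarith)).2 hp)
  exact (lintegral_Ioc_zero_le hp g y).trans_lt (ENNReal.mul_lt_top
    (ENNReal.rpow_lt_top_of_nonneg hexp ENNReal.ofReal_ne_top) hg.2)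

/-- The primitive of `Q` from `0`. The values of `Q` on `(-∞, 0]`, about which nothing is known,
are discarded; this makes the primitive continuous on the whole line. -/
noncomputable def halfLinePrimitive (Q : ℝ → ℝ) (x : ℝ) : ℝ :=
  ∫ t in (0 : ℝ)..x, (Ioi 0).indicator Q t

theorem halfLinePrimitive_eq {Q : ℝ → ℝ} {x : ℝ} (hx : 0 ≤ x) :
    halfLinePrimitive Q x = ∫ t in (0 : ℝ)..x, Q t := by
  rw [halfLinePrimitive, intervalIntegral.integral_of_le hx, intervalIntegral.integral_of_le hx]
  exact setIntegral_congr_fun measurableSet_Ioc fun t ht => indicator_of_mem (s := Ioi 0) ht.1 _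

theorem MemLpL1.intervalIntegrable {p : ℝ} (hp : 1 ≤ p) {Q : ℝ → ℝ} (hQ : MemLpL1 p Q) (a b : ℝ) :
    IntervalIntegrable ((Ioi 0).indicator Q) volume a b := by
  rw [intervalIntegrable_iff, IntegrableOn, integrable_indicator_iff measurableSet_Ioi,
    IntegrableOn, Measure.restrict_restrict measurableSet_Ioi]
  exact (hQ.integrableOn hp (max a b)).mono_set fun t ht => ⟨ht.1, ht.2.2⟩

theorem MemLpL1.continuous_halfLinePrimitive {p : ℝ} (hp : 1 ≤ p) {Q : ℝ → ℝ}
    (hQ : MemLpL1 p Q) : Continuous (halfLinePrimitive Q) :=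
  intervalIntegral.continuous_primitive (fun a b => hQ.intervalIntegrable hp a b) 0

theorem MemLpL1.abs_halfLinePrimitive_sub_le {p : ℝ} (hp : 1 ≤ p) {Q : ℝ → ℝ} (hQ : MemLpL1 p Q)
    {x y : ℝ} (hx : x ∈ Ioi (0 : ℝ)) (hy : y ∈ Ioi (0 : ℝ)) :
    |halfLinePrimitive Q x - halfLinePrimitive Q y| ≤
      2 ^ (1 - 1 / p) * (lpL1Norm p Q).toReal * (1 + |x - y|) ^ (1 - 1 / p) := by
  wlog hyx : y ≤ x generalizing x y
  · rw [abs_sub_comm, abs_sub_comm x]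
    exact this hy hx (le_of_not_ge hyx)
  have hexp : 0 ≤ 1 - 1 / p := sub_nonneg.2 ((div_le_one (by linarith)).2 hp)
  have h1 : halfLinePrimitive Q x - halfLinePrimitive Q y = ∫ t in Ioc y x, Q t := by
    rw [halfLinePrimitive, halfLinePrimitive, intervalIntegral.integral_interval_sub_left
      (hQ.intervalIntegrable hp _ _) (hQ.intervalIntegrable hp _ _),
      intervalIntegral.integral_of_le hyx]
    exact setIntegral_congr_fun measurableSet_Ioc fun t ht =>
      indicator_of_mem (s := Ioi 0) ((mem_Ioi.1 hy).trans ht.1) _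
  have h2 := (enorm_integral_le_lintegral_enorm (μ := volume.restrict (Ioc y x)) Q).trans
    (lintegral_Ioc_le hp Q (mem_Ioi.1 hy).le hyx)
  have hfin : ENNReal.ofReal (2 * (1 + |x - y|)) ^ (1 - 1 / p) * lpL1Norm p Q ≠ ∞ :=
    ENNReal.mul_ne_top (ENNReal.rpow_ne_top_of_nonneg hexp ENNReal.ofReal_ne_top) hQ.2.ne
  have h3 := ENNReal.toReal_mono hfin h2
  rw [toReal_enorm, Real.norm_eq_abs, ENNReal.toReal_mul, ← ENNReal.toReal_rpow,
    ENNReal.toReal_ofReal (by positivity), Real.mul_rpow (by norm_num) (by positivity)] at h3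
  rw [h1]
  linarith

theorem lpL1Norm_add_lt_top {p : ℝ} (hp : 1 ≤ p) {f g : ℝ → ℝ} (hf : MemLpL1 p f)
    (hg : MemLpL1 p g) : lpL1Norm p (fun x => |f x| + |g x|) < ∞ := by
  have hp0 : 0 < p := by linarith
  have hcell : ∀ i, cellNorm (fun x => |f x| + |g x|) i ≤ cellNorm f i + cellNorm g i := by
    intro i
    rw [cellNorm, cellNorm, cellNorm, ← lintegral_add_left'
      (hf.1.mono_measure (Measure.restrict_mono_set _ (cell_subset_Ioi i))).enorm]
    refine lintegral_mono fun x => ?_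
    refine (enorm_add_le _ _).trans (le_of_eq ?_)
    simp only [Real.enorm_eq_ofReal_abs, abs_abs]
  have h1 : lpL1Norm p (fun x => |f x| + |g x|) ^ p ≤
      2 ^ (p - 1) * (lpL1Norm p f ^ p + lpL1Norm p g ^ p) := by
    rw [← tsum_cellNorm_rpow hp0, ← tsum_cellNorm_rpow hp0, ← tsum_cellNorm_rpow hp0,
      ← ENNReal.tsum_add, ← ENNReal.tsum_mul_left]
    exact ENNReal.tsum_le_tsum fun i => (ENNReal.rpow_le_rpow (hcell i) hp0.le).trans
      (ENNReal.rpow_add_le_mul_rpow_add_rpow _ _ hp)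
  have h2 : lpL1Norm p (fun x => |f x| + |g x|) ^ p < ∞ := by
    refine h1.trans_lt (ENNReal.mul_lt_top
      (ENNReal.rpow_lt_top_of_nonneg (by linarith) (by norm_num)) (ENNReal.add_lt_top.2 ⟨?_, ?_⟩))
    exacts [ENNReal.rpow_lt_top_of_nonneg hp0.le hf.2.ne,
      ENNReal.rpow_lt_top_of_nonneg hp0.le hg.2.ne]
  exact (ENNReal.rpow_lt_top_iff_of_pos hp0).1 h2

theorem IsAdapted.lpL1Norm_le {p : ℝ} (hp : 0 < p) {I : ℕ → ℕ → Set ℝ} {f : ℝ → ℝ}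
    (h : IsAdapted p I f) {m j : ℕ} (hm : 1 ≤ m) (hj : j ∈ Finset.Icc 1 (2 ^ m)) :
    lpL1Norm p ((I m j).indicator f) ≤ ((2 : ℝ≥0∞)⁻¹ ^ m) ^ (1 / p) * lpL1Norm p f := by
  have := ENNReal.rpow_le_rpow (h m hm j hj) (one_div_nonneg.2 hp.le)
  rwa [ENNReal.mul_rpow_of_nonneg _ _ (one_div_nonneg.2 hp.le), ← ENNReal.rpow_mul,
    ← ENNReal.rpow_mul, mul_one_div_cancel hp.ne', ENNReal.rpow_one, ENNReal.rpow_one] at this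

/-- Since `p < 2`, the `2 ^ m` intervals of level `m` carry a total squared `ℓ²(L¹)` norm that
decays geometrically in `m`. -/
theorem IsAdapted.tsum_cellNorm_sq_le {p : ℝ} (hp : 0 < p) (hp2 : p ≤ 2) {I : ℕ → ℕ → Set ℝ}
    {f g : ℝ → ℝ} (h : IsAdapted p I f) (hgf : ∀ x, |g x| ≤ |f x|) {m j : ℕ} (hm : 1 ≤ m)
    (hj : j ∈ Finset.Icc 1 (2 ^ m)) :
    ∑' i, cellNorm ((I m j).indicator g) i ^ 2 ≤
      ((2 : ℝ≥0∞)⁻¹ ^ m) ^ (2 / p) * lpL1Norm p f ^ 2 := by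
  have hmono : lpL1Norm p ((I m j).indicator g) ≤ lpL1Norm p ((I m j).indicator f) := by
    refine lpL1Norm_mono hp fun x => ?_
    by_cases hx : x ∈ I m j
    · simpa [hx] using hgf x
    · simp [hx]
  refine (_root_.tsum_cellNorm_sq_le hp hp2 _).trans ?_
  refine (pow_le_pow_left' (hmono.trans (h.lpL1Norm_le hp hm hj)) 2).trans (le_of_eq ?_)
  rw [mul_pow, ← ENNReal.rpow_two (((2 : ℝ≥0∞)⁻¹ ^ m) ^ (1 / p)), ← ENNReal.rpow_mul]
  congr 2
  ring

theorem two_pow_mul_inv_rpow_eq (p : ℝ) (m : ℕ) :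
    (2 : ℝ≥0∞) ^ m * ((2 : ℝ≥0∞)⁻¹ ^ m) ^ (2 / p) =
      ENNReal.ofReal (((2 : ℝ) ^ ((1 - 2 / p) / 4)) ^ (2 * m)) *
        ENNReal.ofReal (((2 : ℝ) ^ ((1 - 2 / p) / 4)) ^ (2 * m)) := by
  have h2 : (2 : ℝ≥0∞) = ENNReal.ofReal 2 := by simp
  rw [h2, ← ENNReal.ofReal_inv_of_pos (by norm_num), ← ENNReal.ofReal_pow (by norm_num),
    ← ENNReal.ofReal_pow (by norm_num), ENNReal.ofReal_rpow_of_pos (by positivity),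
    ← ENNReal.ofReal_mul (by positivity), ← ENNReal.ofReal_mul (by positivity)]
  congr 1
  have h3 : (2 : ℝ)⁻¹ = 2 ^ (-1 : ℝ) := by rw [Real.rpow_neg_one]
  rw [h3]
  simp_rw [← Real.rpow_natCast]
  rw [← Real.rpow_mul (by norm_num), ← Real.rpow_mul (by norm_num), ← Real.rpow_mul (by norm_num),
    ← Real.rpow_add (by norm_num), ← Real.rpow_add (by norm_num)]
  congr 1
  push_cast
  ring

/-! ### Almost everywhere decay -/

theorem aestronglyMeasurable_oscTransform {P : ℝ → ℝ} (hP : Measurable P) {g : ℝ → ℝ}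
    (hg : AEStronglyMeasurable g (volume.restrict (Ioi 0))) (μ : Measure ℝ) [SFinite μ] :
    AEStronglyMeasurable (oscTransform P g) μ := by
  have h1 : AEStronglyMeasurable (fun x => (g x : ℂ)) (volume.restrict (Ioi 0)) :=
    Complex.continuous_ofReal.comp_aestronglyMeasurable hg
  have : AEStronglyMeasurable (fun w : ℝ × ℝ => phaseFactor P w.1 w.2 * (g w.2 : ℂ))
      (μ.prod (volume.restrict (Ioi 0))) :=
    (measurable_phaseFactor hP).aestronglyMeasurable.mul h1.comp_snd
  exact this.integral_prod_right'

section Kernel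

variable {p : ℝ} {σ τ : ℝ → ℝ}

theorem kernelF_sq_eq {k x : ℝ} (hk : 0 < k) (hx : 0 ≤ x) :
    kernelF σ τ x (k ^ 2) = -(Complex.I / (2 * (k : ℂ))) *
      (phaseFactor (halfLinePrimitive (fun x => τ x - σ x ^ 2)) k x *
        (((τ x - σ x ^ 2 : ℝ) : ℂ) + 2 * Complex.I * k * (σ x : ℂ))) := by
  rw [kernelF, ampW, effQTilde, phaseH, Real.sqrt_sq hk.le, intervalIntegral.integral_div,
    phaseFactor, halfLinePrimitive_eq hx]
  simp only [effQ]
  ring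

theorem norm_kernelF_sq_le {k x : ℝ} (hk : 0 < k) (hx : 0 ≤ x) :
    ‖kernelF σ τ x (k ^ 2)‖ ≤ (1 / (2 * k) + 1) * (|τ x - σ x ^ 2| + |σ x|) := by
  rw [kernelF_sq_eq hk hx, norm_mul, norm_mul, norm_phaseFactor, one_mul]
  have h1 : ‖-(Complex.I / (2 * (k : ℂ)))‖ = 1 / (2 * k) := by
    simp [abs_of_pos hk]
  have h2 : ‖((τ x - σ x ^ 2 : ℝ) : ℂ) + 2 * Complex.I * k * (σ x : ℂ)‖ ≤
      |τ x - σ x ^ 2| + 2 * k * |σ x| := by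
    refine (norm_add_le _ _).trans (le_of_eq ?_)
    rw [Complex.norm_real, Real.norm_eq_abs]
    simp [abs_of_pos hk]
  rw [h1]
  refine (mul_le_mul_of_nonneg_left h2 (by positivity)).trans ?_
  have h3 : 1 / (2 * k) * (|τ x - σ x ^ 2| + 2 * k * |σ x|) =
      1 / (2 * k) * |τ x - σ x ^ 2| + |σ x| := by field_simp
  rw [h3]
  have h4 : 0 ≤ 1 / (2 * k) := by positivity
  nlinarith [abs_nonneg (τ x - σ x ^ 2), abs_nonneg (σ x), mul_nonneg h4 (abs_nonneg (σ x))]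

theorem integrableOn_phaseFactor_mul {P : ℝ → ℝ} (hP : Measurable P) (k : ℝ) {g : ℝ → ℝ}
    {A : Set ℝ} (hg : IntegrableOn g A) :
    IntegrableOn (fun x => phaseFactor P k x * (g x : ℂ)) A := by
  have hgc : Integrable (fun x => (g x : ℂ)) (volume.restrict A) := hg.ofReal
  refine hgc.bdd_mul (c := 1) ?_ (Eventually.of_forall fun x => (norm_phaseFactor P k x).le)
  exact ((measurable_phaseFactor hP).comp measurable_prodMk_left).aestronglyMeasurable

theorem integrableOn_kernelF_sq (hp : 1 ≤ p) (hσ : MemLpL1 p σ)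
    (hQ : MemLpL1 p (fun x => τ x - σ x ^ 2)) {k : ℝ} (hk : 0 < k) (y : ℝ) :
    IntegrableOn (fun x => kernelF σ τ x (k ^ 2)) (Ioc 0 y) := by
  have hP := (hQ.continuous_halfLinePrimitive hp).measurable
  have h1 := integrableOn_phaseFactor_mul hP k (hQ.integrableOn hp y)
  have h2 := integrableOn_phaseFactor_mul hP k (hσ.integrableOn hp y)
  have h3 : IntegrableOn (fun x => -(Complex.I / (2 * (k : ℂ))) * _) (Ioc 0 y) :=
    (h1.add (h2.const_mul (2 * Complex.I * (k : ℂ)))).const_mul _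
  refine h3.congr_fun (fun x hx => ?_) measurableSet_Ioc
  rw [kernelF_sq_eq hk hx.1.le]
  simp only [Pi.add_apply]
  ring

theorem oscTransform_indicator {P g : ℝ → ℝ} {k : ℝ} {A : Set ℝ} (hA : MeasurableSet A)
    (hA0 : A ⊆ Ioi 0) :
    oscTransform P (A.indicator g) k = ∫ x in A, phaseFactor P k x * (g x : ℂ) := by
  have : (fun x => phaseFactor P k x * ((A.indicator g x : ℝ) : ℂ)) =
      A.indicator fun x => phaseFactor P k x * (g x : ℂ) := by
    ext x
    by_cases hx : x ∈ A <;> simp [hx]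
  rw [oscTransform, this, setIntegral_indicator hA, inter_eq_right.2 hA0]

theorem integral_kernelF_sq_eq (hp : 1 ≤ p) (hσ : MemLpL1 p σ)
    (hQ : MemLpL1 p (fun x => τ x - σ x ^ 2)) {k : ℝ} (hk : 0 < k) {A : Set ℝ}
    (hA : MeasurableSet A) {y : ℝ} (hAy : A ⊆ Ioc 0 y) :
    ∫ x in A, kernelF σ τ x (k ^ 2) = -(Complex.I / (2 * (k : ℂ))) *
      (oscTransform (halfLinePrimitive (fun x => τ x - σ x ^ 2))
          (A.indicator (fun x => τ x - σ x ^ 2)) k +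
        2 * Complex.I * k *
          oscTransform (halfLinePrimitive (fun x => τ x - σ x ^ 2)) (A.indicator σ) k) := by
  have hA0 : A ⊆ Ioi 0 := hAy.trans Ioc_subset_Ioi_self
  have hP := (hQ.continuous_halfLinePrimitive hp).measurable
  have h1 := integrableOn_phaseFactor_mul hP k ((hQ.integrableOn hp y).mono_set hAy)
  have h2 := integrableOn_phaseFactor_mul hP k ((hσ.integrableOn hp y).mono_set hAy)
  rw [oscTransform_indicator hA hA0, oscTransform_indicator hA hA0, ← integral_const_mul,
    ← integral_add h1 (h2.const_mul _), ← integral_const_mul]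
  refine setIntegral_congr_fun hA fun x hx => ?_
  rw [kernelF_sq_eq hk (mem_Ioi.1 (hA0 hx)).le]
  ring

theorem enorm_integral_kernelF_sq_le (hp : 1 ≤ p) (hσ : MemLpL1 p σ)
    (hQ : MemLpL1 p (fun x => τ x - σ x ^ 2)) {a k : ℝ} (ha : 0 < a) (hk : a ≤ k) {A : Set ℝ}
    (hA : MeasurableSet A) {y : ℝ} (hAy : A ⊆ Ioc 0 y) :
    ‖∫ x in A, kernelF σ τ x (k ^ 2)‖ₑ ^ 2 ≤ ENNReal.ofReal (1 / (2 * a ^ 2) + 2) *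
      (‖oscTransform (halfLinePrimitive (fun x => τ x - σ x ^ 2))
          (A.indicator (fun x => τ x - σ x ^ 2)) k‖ₑ ^ 2 +
        ‖oscTransform (halfLinePrimitive (fun x => τ x - σ x ^ 2)) (A.indicator σ) k‖ₑ ^ 2) := by
  have hk0 : 0 < k := ha.trans_le hk
  rw [integral_kernelF_sq_eq hp hσ hQ hk0 hA hAy]
  set u := oscTransform (halfLinePrimitive (fun x => τ x - σ x ^ 2))
    (A.indicator (fun x => τ x - σ x ^ 2)) k
  set v := oscTransform (halfLinePrimitive (fun x => τ x - σ x ^ 2)) (A.indicator σ) k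
  rw [← ofReal_norm, ← ofReal_norm u, ← ofReal_norm v, ← ENNReal.ofReal_pow (norm_nonneg _),
    ← ENNReal.ofReal_pow (norm_nonneg _), ← ENNReal.ofReal_pow (norm_nonneg _),
    ← ENNReal.ofReal_add (sq_nonneg _) (sq_nonneg _), ← ENNReal.ofReal_mul (by positivity)]
  refine ENNReal.ofReal_le_ofReal ?_
  have h1 : ‖-(Complex.I / (2 * (k : ℂ))) * (u + 2 * Complex.I * k * v)‖ ≤
      1 / (2 * a) * ‖u‖ + ‖v‖ := by
    have h2 : -(Complex.I / (2 * (k : ℂ))) * (u + 2 * Complex.I * k * v) =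
        -(Complex.I / (2 * (k : ℂ))) * u + v := by
      have : (k : ℂ) ≠ 0 := Complex.ofReal_ne_zero.2 hk0.ne'
      field_simp
      ring_nf
      simp only [Complex.I_sq]
      ring
    rw [h2]
    refine (norm_add_le _ _).trans (add_le_add_left ?_ _)
    rw [norm_mul]
    refine mul_le_mul_of_nonneg_right ?_ (norm_nonneg _)
    have h3 : ‖-(Complex.I / (2 * (k : ℂ)))‖ = 1 / (2 * k) := by simp [abs_of_pos hk0]
    rw [h3]
    exact one_div_le_one_div_of_le (by positivity) (by linarith)
  refine (pow_le_pow_left₀ (norm_nonneg _) h1 2).trans ?_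
  have h4 : 1 / (2 * a ^ 2) = 2 * (1 / (2 * a)) ^ 2 := by field_simp
  rw [h4]
  set c := 1 / (2 * a)
  nlinarith [sq_nonneg (c * ‖u‖ - ‖v‖), sq_nonneg (c * ‖v‖), sq_nonneg ‖u‖, sq_nonneg ‖v‖]

end Kernel

/-- A weighted Borel–Cantelli argument: if the integrals of `U m` decay like `δ ^ 2`, where
`δ = δ m` is summable, then `U m` is almost everywhere bounded by a multiple of `δ`. -/
theorem ae_exists_le_mul {μ : Measure ℝ} {φ : ℝ → ℝ} (hφ : Measurable φ)
    (hφ0 : ∀ᵐ k ∂μ, 0 < φ k) {U : ℕ → ℝ → ℝ≥0∞} (hU : ∀ m, AEMeasurable (U m) μ) {δ : ℕ → ℝ}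
    (hδ0 : ∀ m, 0 < δ m) (hδ : Summable δ) {C : ℝ≥0∞} (hC : C ≠ ∞)
    (h : ∀ m, 1 ≤ m → ∫⁻ k, ENNReal.ofReal (φ k) * U m k ∂μ ≤
      C * (ENNReal.ofReal (δ m) * ENNReal.ofReal (δ m))) :
    ∀ᵐ k ∂μ, ∃ S : ℝ, 0 ≤ S ∧ ∀ m, 1 ≤ m → U m k ≤ ENNReal.ofReal (S * δ m) := by
  set V : ℕ → ℝ → ℝ≥0∞ := fun n k =>
    (ENNReal.ofReal (δ (n + 1)))⁻¹ * (ENNReal.ofReal (φ k) * U (n + 1) k) with hV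
  have hd0 : ∀ m, ENNReal.ofReal (δ m) ≠ 0 := fun m => (ENNReal.ofReal_pos.2 (hδ0 m)).ne'
  have hVm : ∀ n, AEMeasurable (V n) μ := fun n =>
    (hφ.ennreal_ofReal.aemeasurable.mul (hU (n + 1))).const_mul _
  have hVi : ∀ n, ∫⁻ k, V n k ∂μ ≤ C * ENNReal.ofReal (δ (n + 1)) := by
    intro n
    rw [hV]
    simp only
    rw [lintegral_const_mul' _ _ (ENNReal.inv_ne_top.2 (hd0 _))]
    refine (mul_le_mul_right (h (n + 1) (by omega)) _).trans (le_of_eq ?_)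
    rw [mul_left_comm, ← mul_assoc (ENNReal.ofReal (δ (n + 1)))⁻¹,
      ENNReal.inv_mul_cancel (hd0 _) ENNReal.ofReal_ne_top, one_mul]
  have hfin : ∫⁻ k, ∑' n, V n k ∂μ ≠ ∞ := by
    rw [lintegral_tsum hVm]
    refine ne_top_of_le_ne_top ?_ (ENNReal.tsum_le_tsum hVi)
    rw [ENNReal.tsum_mul_left, ← ENNReal.ofReal_tsum_of_nonneg (fun n => (hδ0 _).le)
      ((summable_nat_add_iff 1).2 hδ)]
    exact ENNReal.mul_ne_top hC ENNReal.ofReal_ne_top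
  filter_upwards [ae_lt_top' (AEMeasurable.tsum hVm) hfin, hφ0] with k hk hφk
  refine ⟨(∑' n, V n k).toReal / φ k, by positivity, fun m hm => ?_⟩
  obtain ⟨n, rfl⟩ : ∃ n, m = n + 1 := ⟨m - 1, by omega⟩
  have h1 : V n k ≤ ENNReal.ofReal (∑' n, V n k).toReal := by
    rw [ENNReal.ofReal_toReal hk.ne]; exact ENNReal.le_tsum n
  have hφk0 : ENNReal.ofReal (φ k) ≠ 0 := (ENNReal.ofReal_pos.2 hφk).ne'
  have h2 : U (n + 1) k = ENNReal.ofReal (δ (n + 1)) * ((ENNReal.ofReal (φ k))⁻¹ * V n k) := by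
    rw [hV]
    simp only
    rw [mul_left_comm (ENNReal.ofReal (φ k))⁻¹, ← mul_assoc (ENNReal.ofReal (φ k))⁻¹,
      ENNReal.inv_mul_cancel hφk0 ENNReal.ofReal_ne_top, one_mul, ← mul_assoc,
      ENNReal.mul_inv_cancel (hd0 _) ENNReal.ofReal_ne_top, one_mul]
  rw [h2, div_eq_inv_mul, mul_comm _ (δ (n + 1)), ENNReal.ofReal_mul (hδ0 _).le,
    ENNReal.ofReal_mul (inv_nonneg.2 hφk.le), ENNReal.ofReal_inv_of_pos hφk]
  gcongr

theorem tendsto_mul_inv_pow_rpow {p : ℝ} (hp : 0 < p) {A B : ℝ≥0∞} (hA : A ≠ ∞) (hB : B ≠ ∞)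
    (W : ℝ) :
    Tendsto (fun m : ℕ => W * (A * (((2 : ℝ≥0∞)⁻¹ ^ m) ^ (1 / p) * B)).toReal) atTop (𝓝 0) := by
  have h1 : Tendsto (fun m : ℕ => (2 : ℝ≥0∞)⁻¹ ^ m) atTop (𝓝 0) :=
    ENNReal.tendsto_pow_atTop_nhds_zero_of_lt_one (by norm_num)
  have h2 := (ENNReal.continuous_rpow_const (y := 1 / p)).tendsto 0 |>.comp h1
  rw [ENNReal.zero_rpow_of_pos (one_div_pos.2 hp)] at h2
  have h3 := ENNReal.Tendsto.const_mul (ENNReal.Tendsto.mul_const h2 (Or.inr hB)) (Or.inr hA)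
  rw [zero_mul, mul_zero] at h3
  have h4 := ((ENNReal.tendsto_toReal ENNReal.zero_ne_top).comp h3).const_mul W
  simpa using h4

section Decay

variable {p : ℝ} {σ τ : ℝ → ℝ} {I : ℕ → ℕ → Set ℝ}

/-- The qualitative smallness needed for `GeometricDecay` holds at every energy. -/
theorem norm_integral_kernelF_sq_inter_le (hp : 1 ≤ p) (hσ : MemLpL1 p σ)
    (hQ : MemLpL1 p (fun x => τ x - σ x ^ 2)) (hI : IsMartingaleStructure I)
    (hadapt : IsAdapted p I (fun x => |τ x - σ x ^ 2| + |σ x|)) {k : ℝ} (hk : 0 < k) (y : ℝ)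
    {m j : ℕ} (hm : 1 ≤ m) (hj : j ∈ Finset.Icc 1 (2 ^ m)) :
    ‖∫ x in I m j ∩ Ioc 0 y, kernelF σ τ x (k ^ 2)‖ ≤ (1 / (2 * k) + 1) *
      (ENNReal.ofReal (2 * (1 + |y|)) ^ (1 - 1 / p) * (((2 : ℝ≥0∞)⁻¹ ^ m) ^ (1 / p) *
        lpL1Norm p (fun x => |τ x - σ x ^ 2| + |σ x|))).toReal := by
  have hp0 : 0 < p := by linarith
  have hexp : 0 ≤ 1 - 1 / p := sub_nonneg.2 ((div_le_one hp0).2 hp)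
  set f : ℝ → ℝ := fun x => |τ x - σ x ^ 2| + |σ x| with hf
  have hN : lpL1Norm p f ≠ ∞ := (lpL1Norm_add_lt_top hp hQ hσ).ne
  set W := 1 / (2 * k) + 1 with hW
  have hW0 : 0 ≤ W := by positivity
  have hA : MeasurableSet (I m j ∩ Ioc 0 y) := (hI.measurableSet hm hj).inter measurableSet_Ioc
  have h1 : ‖∫ x in I m j ∩ Ioc 0 y, kernelF σ τ x (k ^ 2)‖ₑ ≤
      ENNReal.ofReal W * ∫⁻ x in Ioc 0 y, ‖(I m j).indicator f x‖ₑ := by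
    refine (enorm_integral_le_lintegral_enorm _).trans ?_
    have h2 : ∫⁻ x in I m j ∩ Ioc 0 y, ‖kernelF σ τ x (k ^ 2)‖ₑ ≤
        ∫⁻ x in I m j ∩ Ioc 0 y, ENNReal.ofReal W * ‖(I m j).indicator f x‖ₑ := by
      refine setLIntegral_mono' hA fun x hx => ?_
      rw [indicator_of_mem hx.1, Real.enorm_eq_ofReal_abs, ← ENNReal.ofReal_mul hW0, ← ofReal_norm]
      refine ENNReal.ofReal_le_ofReal ((norm_kernelF_sq_le hk hx.2.1.le).trans ?_)
      exact mul_le_mul_of_nonneg_left (le_abs_self _) hW0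
    refine h2.trans ?_
    rw [lintegral_const_mul' _ _ ENNReal.ofReal_ne_top]
    gcongr
    exact inter_subset_right
  have h2 := (lintegral_Ioc_zero_le hp ((I m j).indicator f) y).trans
    (mul_le_mul_right (hadapt.lpL1Norm_le hp0 hm hj) _)
  have hfin : ENNReal.ofReal (2 * (1 + |y|)) ^ (1 - 1 / p) *
      (((2 : ℝ≥0∞)⁻¹ ^ m) ^ (1 / p) * lpL1Norm p f) ≠ ∞ := by
    refine ENNReal.mul_ne_top (ENNReal.rpow_ne_top_of_nonneg hexp ENNReal.ofReal_ne_top)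
      (ENNReal.mul_ne_top (ENNReal.rpow_ne_top_of_nonneg (one_div_nonneg.2 hp0.le)
        (ENNReal.pow_ne_top (by norm_num))) hN)
  have h3 := ENNReal.toReal_mono (ENNReal.mul_ne_top ENNReal.ofReal_ne_top hfin)
    (h1.trans (mul_le_mul_right h2 (ENNReal.ofReal W)))
  rwa [toReal_enorm, ENNReal.toReal_mul, ENNReal.toReal_ofReal hW0] at h3

open Classical in
/-- The majorant of `bddSquareSum` formed with the oscillatory transforms of `Q` and of `σ`. -/
noncomputable def oscSquareSum (σ τ : ℝ → ℝ) (I : ℕ → ℕ → Set ℝ) (m : ℕ) (k : ℝ) : ℝ≥0∞ :=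
  ∑ j ∈ Finset.Icc 1 (2 ^ m) with BddAbove (I m j),
    (‖oscTransform (halfLinePrimitive (fun x => τ x - σ x ^ 2))
        ((I m j).indicator (fun x => τ x - σ x ^ 2)) k‖ₑ ^ 2 +
      ‖oscTransform (halfLinePrimitive (fun x => τ x - σ x ^ 2)) ((I m j).indicator σ) k‖ₑ ^ 2)

theorem ofReal_bddSquareSum_le (hp : 1 ≤ p) (hσ : MemLpL1 p σ)
    (hQ : MemLpL1 p (fun x => τ x - σ x ^ 2)) (hI : IsMartingaleStructure I) {a k : ℝ}
    (ha : 0 < a) (hk : a ≤ k) {m : ℕ} (hm : 1 ≤ m) :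
    ENNReal.ofReal (bddSquareSum I (fun x => kernelF σ τ x (k ^ 2)) m) ≤
      ENNReal.ofReal (1 / (2 * a ^ 2) + 2) * oscSquareSum σ τ I m k := by
  classical
  rw [bddSquareSum, oscSquareSum, ENNReal.ofReal_sum_of_nonneg fun _ _ => sq_nonneg _,
    Finset.mul_sum]
  refine Finset.sum_le_sum fun j hj => ?_
  obtain ⟨hj, B, hB⟩ := Finset.mem_filter.1 hj
  rw [ENNReal.ofReal_pow (norm_nonneg _), ofReal_norm]
  exact enorm_integral_kernelF_sq_le hp hσ hQ ha hk (hI.measurableSet hm hj)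
    (fun x hx => ⟨hI.subset_Ioi hm hj hx, hB hx⟩)

theorem integrableOn_indicator_of_bddAbove (hp : 1 ≤ p) {g : ℝ → ℝ} (hg : MemLpL1 p g)
    (hI : IsMartingaleStructure I) {m j : ℕ} (hm : 1 ≤ m) (hj : j ∈ Finset.Icc 1 (2 ^ m))
    (hb : BddAbove (I m j)) : IntegrableOn ((I m j).indicator g) (Ioi 0) := by
  obtain ⟨B, hB⟩ := hb
  refine Integrable.mono_measure ((integrable_indicator_iff (hI.measurableSet hm hj)).2 ?_)
    Measure.restrict_le_self
  exact (hg.integrableOn hp B).mono_set fun x hx => ⟨hI.subset_Ioi hm hj hx, hB hx⟩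

theorem aemeasurable_enorm_oscTransform_sq (hp : 1 ≤ p) (hQ : MemLpL1 p (fun x => τ x - σ x ^ 2))
    {g : ℝ → ℝ} (hg : MemLpL1 p g) (hI : IsMartingaleStructure I) {m j : ℕ} (hm : 1 ≤ m)
    (hj : j ∈ Finset.Icc 1 (2 ^ m)) (μ : Measure ℝ) [SFinite μ] :
    AEMeasurable (fun k => ‖oscTransform (halfLinePrimitive (fun x => τ x - σ x ^ 2))
      ((I m j).indicator g) k‖ₑ ^ 2) μ :=
  (aestronglyMeasurable_oscTransform (hQ.continuous_halfLinePrimitive hp).measurable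
    (hg.1.indicator (hI.measurableSet hm hj)) μ).enorm.pow_const 2

theorem aemeasurable_oscSquareSum (hp : 1 ≤ p) (hσ : MemLpL1 p σ)
    (hQ : MemLpL1 p (fun x => τ x - σ x ^ 2)) (hI : IsMartingaleStructure I) {m : ℕ} (hm : 1 ≤ m)
    (μ : Measure ℝ) [SFinite μ] : AEMeasurable (oscSquareSum σ τ I m) μ := by
  classical
  refine Finset.aemeasurable_fun_sum _ fun j hj => ?_
  have hj' := (Finset.mem_filter.1 hj).1
  exact (aemeasurable_enorm_oscTransform_sq hp hQ hQ hI hm hj' μ).add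
    (aemeasurable_enorm_oscTransform_sq hp hQ hσ hI hm hj' μ)

/-- The `L²` estimate turns the adaptedness of the structure into geometric decay: the exponent
of `2 ^ m` on the right is `1 - 2 / p < 0`. -/
theorem exists_forall_lintegral_oscSquareSum_le (hp : 1 ≤ p) (hp2 : p < 2) (hσ : MemLpL1 p σ)
    (hQ : MemLpL1 p (fun x => τ x - σ x ^ 2)) (hI : IsMartingaleStructure I)
    (hadapt : IsAdapted p I (fun x => |τ x - σ x ^ 2| + |σ x|)) {a b : ℝ} (ha : 0 < a)
    (hab : a ≤ b) :
    ∃ C : ℝ≥0∞, C ≠ ∞ ∧ ∀ m, 1 ≤ m →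
      ∫⁻ k in Ioc a b, ENNReal.ofReal (bumpWeight a b k) * oscSquareSum σ τ I m k ≤
        C * ((2 : ℝ≥0∞) ^ m * ((2 : ℝ≥0∞)⁻¹ ^ m) ^ (2 / p)) := by
  classical
  have hp0 : 0 < p := by linarith
  have hs0 : 0 ≤ 1 - 1 / p := sub_nonneg.2 ((div_le_one hp0).2 hp)
  have hs1 : 1 - 1 / p < 1 / 2 := by
    have : 1 / 2 < 1 / p := one_div_lt_one_div_of_lt hp0 hp2
    linarith
  set f : ℝ → ℝ := fun x => |τ x - σ x ^ 2| + |σ x| with hf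
  set P := halfLinePrimitive (fun x => τ x - σ x ^ 2) with hPdef
  have hN : lpL1Norm p f ≠ ∞ := (lpL1Norm_add_lt_top hp hQ hσ).ne
  have hP : Measurable P := (hQ.continuous_halfLinePrimitive hp).measurable
  obtain ⟨C, hC, hCb⟩ := exists_forall_lintegral_oscTransform_le ha hab (by positivity) hs0 hs1 hP
    (fun x hx y hy => hQ.abs_halfLinePrimitive_sub_le hp hx hy)
  refine ⟨2 * C * lpL1Norm p f ^ 2, ENNReal.mul_ne_top (ENNReal.mul_ne_top (by norm_num) hC)
    (ENNReal.pow_ne_top hN), fun m hm => ?_⟩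
  set ρ := ((2 : ℝ≥0∞)⁻¹ ^ m) ^ (2 / p) with hρ
  have hφ : Measurable fun k => ENNReal.ofReal (bumpWeight a b k) :=
    (continuous_bumpWeight a b).measurable.ennreal_ofReal
  have hterm : ∀ g : ℝ → ℝ, MemLpL1 p g → (∀ x, |g x| ≤ |f x|) → ∀ j ∈ Finset.Icc 1 (2 ^ m),
      BddAbove (I m j) → ∫⁻ k in Ioc a b, ENNReal.ofReal (bumpWeight a b k) *
        ‖oscTransform P ((I m j).indicator g) k‖ₑ ^ 2 ≤ C * (ρ * lpL1Norm p f ^ 2) := by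
    intro g hg hgf j hj hb
    refine (hCb _ (integrableOn_indicator_of_bddAbove hp hg hI hm hj hb)).trans ?_
    gcongr
    exact hadapt.tsum_cellNorm_sq_le hp0 hp2.le hgf hm hj
  have hmeas : ∀ g : ℝ → ℝ, MemLpL1 p g → ∀ j ∈ Finset.Icc 1 (2 ^ m),
      AEMeasurable (fun k => ENNReal.ofReal (bumpWeight a b k) *
        ‖oscTransform P ((I m j).indicator g) k‖ₑ ^ 2) (volume.restrict (Ioc a b)) :=
    fun g hg j hj => hφ.aemeasurable.mul
      (aemeasurable_enorm_oscTransform_sq hp hQ hg hI hm hj _)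
  have hQf : ∀ x, |τ x - σ x ^ 2| ≤ |f x| := fun x => by
    rw [hf]; simp only
    exact (le_add_of_nonneg_right (abs_nonneg _)).trans (le_abs_self _)
  have hσf : ∀ x, |σ x| ≤ |f x| := fun x => by
    rw [hf]; simp only
    exact (le_add_of_nonneg_left (abs_nonneg _)).trans (le_abs_self _)
  simp_rw [oscSquareSum, Finset.mul_sum, mul_add]
  rw [lintegral_finsetSum']
  swap
  · exact fun j hj => (hmeas _ hQ j (Finset.mem_filter.1 hj).1).add
      (hmeas _ hσ j (Finset.mem_filter.1 hj).1)
  calc _ ≤ ∑ j ∈ Finset.Icc 1 (2 ^ m) with BddAbove (I m j),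
        (C * (ρ * lpL1Norm p f ^ 2) + C * (ρ * lpL1Norm p f ^ 2)) := by
        refine Finset.sum_le_sum fun j hj => ?_
        obtain ⟨hj, hb⟩ := Finset.mem_filter.1 hj
        rw [lintegral_add_left' (hmeas _ hQ j hj)]
        exact add_le_add (hterm _ hQ hQf j hj hb) (hterm _ hσ hσf j hj hb)
    _ ≤ ∑ j ∈ Finset.Icc 1 (2 ^ m),
        (C * (ρ * lpL1Norm p f ^ 2) + C * (ρ * lpL1Norm p f ^ 2)) :=
        Finset.sum_le_sum_of_subset (Finset.filter_subset _ _)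
    _ = 2 * C * lpL1Norm p f ^ 2 * ((2 : ℝ≥0∞) ^ m * ρ) := by
        rw [Finset.sum_const, Nat.card_Icc, nsmul_eq_mul]
        push_cast [Nat.add_sub_cancel]
        ring

theorem ae_exists_geometricDecay_Ioo (hp : 1 ≤ p) (hp2 : p < 2) (hσ : MemLpL1 p σ)
    (hQ : MemLpL1 p (fun x => τ x - σ x ^ 2)) (hI : IsMartingaleStructure I)
    (hadapt : IsAdapted p I (fun x => |τ x - σ x ^ 2| + |σ x|)) {a b : ℝ} (ha : 0 < a)
    (hab : a ≤ b) :
    ∀ᵐ k ∂(volume.restrict (Ioo a b)),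
      ∃ C θ : ℝ, GeometricDecay I (fun x => kernelF σ τ x (k ^ 2)) C θ := by
  have hp0 : 0 < p := by linarith
  have hs0 : 0 ≤ 1 - 1 / p := sub_nonneg.2 ((div_le_one hp0).2 hp)
  obtain ⟨C, hC, hCb⟩ := exists_forall_lintegral_oscSquareSum_le hp hp2 hσ hQ hI hadapt ha hab
  set θ : ℝ := 2 ^ ((1 - 2 / p) / 4) with hθ
  have hθ0 : 0 < θ := by positivity
  have hθ1 : θ < 1 := by
    refine Real.rpow_lt_one_of_one_lt_of_neg (by norm_num) ?_
    have : 1 < 2 / p := (one_lt_div hp0).2 hp2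
    linarith
  have hsum : Summable fun m : ℕ => θ ^ (2 * m) := by
    simp_rw [pow_mul]
    exact summable_geometric_of_lt_one (sq_nonneg θ) (pow_lt_one₀ hθ0.le hθ1 (by norm_num))
  -- `oscSquareSum` at level `0` is irrelevant, and is replaced by `0` to spare its measurability.
  have hae := ae_exists_le_mul (μ := volume.restrict (Ioo a b)) (φ := bumpWeight a b)
    (continuous_bumpWeight a b).measurable
    (ae_restrict_of_forall_mem measurableSet_Ioo fun k hk => bumpWeight_pos hk)
    (U := fun m => if 1 ≤ m then oscSquareSum σ τ I m else 0)
    (fun m => by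
      by_cases hm : 1 ≤ m
      · simp only [hm, if_true]
        exact aemeasurable_oscSquareSum hp hσ hQ hI hm _
      · simp only [hm, if_false]
        exact aemeasurable_const)
    (fun m => pow_pos hθ0 _) hsum hC (fun m hm => by
      simp only [hm, if_true]
      rw [hθ, ← two_pow_mul_inv_rpow_eq]
      exact (lintegral_mono_set Ioo_subset_Ioc_self).trans (hCb m hm))
  filter_upwards [hae, ae_restrict_mem measurableSet_Ioo] with k hk hkab
  obtain ⟨S, hS0, hS⟩ := hk
  have hk0 : 0 < k := ha.trans hkab.1
  set c := 1 / (2 * a ^ 2) + 2 with hc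
  have hc0 : 0 ≤ c := by positivity
  refine ⟨√(c * S), θ, fun y => integrableOn_kernelF_sq hp hσ hQ hk0 y, Real.sqrt_nonneg _, hθ0,
    hθ1, fun m hm => ?_, fun y => ⟨_, tendsto_mul_inv_pow_rpow hp0
      (ENNReal.rpow_ne_top_of_nonneg hs0 ENNReal.ofReal_ne_top)
      (lpL1Norm_add_lt_top hp hQ hσ).ne _, fun m hm j hj =>
        norm_integral_kernelF_sq_inter_le hp hσ hQ hI hadapt hk0 y hm hj⟩⟩
  have h1 := hS m hm
  simp only [hm, if_true] at h1
  have h2 := (ofReal_bddSquareSum_le hp hσ hQ hI ha hkab.1.le hm).trans (mul_le_mul_right h1 _)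
  rw [← ENNReal.ofReal_mul hc0, ENNReal.ofReal_le_ofReal_iff (by positivity)] at h2
  rw [mul_pow, Real.sq_sqrt (by positivity), ← pow_mul, mul_comm m 2]
  linarith

theorem ae_exists_geometricDecay (hp : 1 ≤ p) (hp2 : p < 2) (hσ : MemLpL1 p σ)
    (hQ : MemLpL1 p (fun x => τ x - σ x ^ 2)) (hI : IsMartingaleStructure I)
    (hadapt : IsAdapted p I (fun x => |τ x - σ x ^ 2| + |σ x|)) :
    ∀ᵐ k ∂(volume.restrict (Ioi (0 : ℝ))),
      ∃ C θ : ℝ, GeometricDecay I (fun x => kernelF σ τ x (k ^ 2)) C θ := by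
  have hcover : Ioi (0 : ℝ) ⊆ ⋃ n : ℕ, Ioo (1 / ((n : ℝ) + 1)) ((n : ℝ) + 1) := by
    intro k hk
    obtain ⟨n, hn⟩ := exists_nat_gt (max k (1 / k))
    refine mem_iUnion.2 ⟨n, ?_, ?_⟩
    · rw [one_div_lt (by positivity) hk]
      linarith [le_max_right k (1 / k)]
    · linarith [le_max_left k (1 / k)]
  refine ae_restrict_of_ae_restrict_of_subset hcover ((ae_restrict_iUnion_iff _ _).2 fun n => ?_)
  refine ae_exists_geometricDecay_Ioo hp hp2 hσ hQ hI hadapt (by positivity) ?_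
  have h1 : (1 : ℝ) ≤ n + 1 := by linarith [(Nat.cast_nonneg n : (0 : ℝ) ≤ n)]
  exact ((div_le_one (by linarith)).2 h1).trans h1

end Decay

/-- The square map sends null sets to null sets, so energies and wave numbers `k = √E` have the
same exceptional sets. -/
theorem ae_Ioi_of_ae_sq {S : ℝ → Prop} (h : ∀ᵐ k ∂(volume.restrict (Ioi (0 : ℝ))), S (k ^ 2)) :
    ∀ᵐ E ∂(volume.restrict (Ioi (0 : ℝ))), S E := by
  rw [ae_restrict_iff' measurableSet_Ioi, ae_iff] at h ⊢
  have himg := addHaar_image_eq_zero_of_differentiableOn_of_addHaar_eq_zero (f := fun k : ℝ => k ^ 2)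
    volume (by fun_prop) h
  refine measure_mono_null (fun E hE => ?_) himg
  simp only [mem_ofPred_eq, Classical.not_imp] at hE
  have hE0 : 0 < E := hE.1
  refine ⟨√E, ?_, Real.sq_sqrt hE0.le⟩
  simp only [mem_ofPred_eq, Classical.not_imp]
  exact ⟨Real.sqrt_pos.2 hE0, by rw [Real.sq_sqrt hE0.le]; exact hE.2⟩

theorem mainTheorem6 (p : ℝ) (hp1 : 1 ≤ p) (hp2 : p < 2) (σ τ : ℝ → ℝ)
    (hσ : MemLpL1 p σ) (hQ : MemLpL1 p (fun x => τ x - σ x ^ 2))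
    (I : ℕ → ℕ → Set ℝ) (hI : IsMartingaleStructure I)
    (hadapt : IsAdapted p I (fun x => |τ x - σ x ^ 2| + |σ x|)) :
    ∀ᵐ E ∂(volume.restrict (Ioi (0 : ℝ))),
      (∀ M : ℝ, ∀ m, 1 ≤ m → ∀ j ∈ Finset.Icc 1 (2 ^ m),
        ∃ c : ℂ, HasHalfLineIntegral (tailF σ τ E M) (I m j) c) ∧
      limsup (fun M : ℝ => BNorm 1 I (tailF σ τ E M)) atTop = 0 := by
  refine ae_Ioi_of_ae_sq ?_
  filter_upwards [ae_exists_geometricDecay hp1 hp2 hσ hQ hI hadapt] with k hk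
  obtain ⟨C, θ, h⟩ := hk
  refine ⟨fun M m hm j hj => ?_, (h.tendsto_BNorm hI).limsup_eq⟩
  obtain ⟨c, hc⟩ := h.exists_tendsto_integral_inter hI hm hj
  exact ⟨_, h.hasHalfLineIntegral_indicator (hI.measurableSet hm hj) hc M⟩
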